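/- Let $d\ge 1$, let $J\subset\mathbb R^d$ be compact with non-empty interior, let $n_k\ge 2$ $(k\ge1)$ be integers and let $c_{k,j}\in(0,1)$ $(k\ge 1,\ 1\le j\le n_k)$. Let $D^k$ be the set of words $i_1\cdots i_k$ with $1\le i_t\le n_t$. Let $E\in\mathcal M(J,\{n_k\},\{c_{k,j}\})$ be a (general) Moran set, that is, $E=\bigcap_{k\ge0}\bigcup_{\sigma\in D^k}J_\sigma$, where $J_\emptyset=J$, every $J_\sigma$ is the image of $J$ under a similarity of $\mathbb R^d$, and for all $k\ge1$ and $\sigma\in D^{k-1}$ the sets $J_{\sigma1},\dots,J_{\sigma n_k}$ are contained in $J_\sigma$, have pairwise disjoint interiors, and satisfy $|J_{\sigma j}|/|J_\sigma|=c_{k,j}$ (where $|\cdot|$ is the diameter). For a metric space $X$ let $N_{r,R}(X)$ be the smallest number of closed balls of radius $r$ needed to cover any closed ball of radius $R$, let $$h_X(\delta)=\inf\Bigl\{\alpha\ge0:\ \exists\, b,c>0\ \text{ s.t. } N_{r,R}(X)\le c\,(R/r)^{\alpha}\ \text{ for all } 0<r<r^{1-\delta}\le R<b\Bigr\}\qquad(0<\delta<1),$$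 and let $\dim_{qA}X=\lim_{\delta\to0^+}h_X(\delta)$ be the quasi-Assouad dimension. For $1\le p\le q$ let $s_{p,q}$ be the unique positive solution $s$ of $$\prod_{i=p}^{q}\ \sum_{j=1}^{n_i}c_{i,j}^{\,s}=1 .$$ If $\inf_{k,j}c_{k,j}>0$, then $$\dim_{qA}E=\lim_{\eta\to0^+}\ \limsup_{q\to\infty}\ \max_{1\le p\le q(1-\eta)}s_{p,q}.$$ -/

import Mathlib

open Set Filter Topology
open scoped NNReal ENNReal

noncomputable section

/-- `coverNum X r R` is the smallest number `N_{r,R}(X)` such that every closed ball of radius `R`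
in the metric space `X` can be covered by that many closed balls of `X` of radius `r`. -/
def coverNum (X : Type*) [PseudoMetricSpace X] (r R : ℝ≥0) : ℕ∞ :=
  ⨆ x : X, Metric.externalCoveringNumber r (Metric.closedBall x (R : ℝ))

/-- The infimum `h_X(δ)` of the `α ≥ 0` for which there are `b, c > 0` with
`N_{r,R}(X) ≤ c (R/r)^α` whenever `0 < r < r^(1-δ) ≤ R < b` (it is `∞` if there is no such `α`). -/
def hExponent (X : Type*) [PseudoMetricSpace X] (δ : ℝ) : ℝ≥0∞ :=
  ⨅ (α : ℝ≥0) (_ : ∃ b c : ℝ≥0, 0 < b ∧ 0 < c ∧ ∀ r R : ℝ≥0,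
      0 < r → r < r ^ (1 - δ) → r ^ (1 - δ) ≤ R → R < b →
        (coverNum X r R : ℝ≥0∞) ≤ ((c * (R / r) ^ (α : ℝ) : ℝ≥0) : ℝ≥0∞)), (α : ℝ≥0∞)

/-- The quasi-Assouad dimension `dim_qA X = lim_{δ → 0+} h_X(δ)`. -/
def qaDim (X : Type*) [PseudoMetricSpace X] : ℝ≥0∞ :=
  limUnder (𝓝[>] (0 : ℝ)) (hExponent X)

/-- `h_X` is nonincreasing on `(0, 1)`. -/
lemma hExponent_antitoneOn (X : Type*) [PseudoMetricSpace X] :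
    AntitoneOn (hExponent X) (Ioo (0 : ℝ) 1) := by
  intro δ hδ δ' hδ' hle
  refine le_iInf₂ fun α hα => iInf₂_le_of_le α ?_ le_rfl
  obtain ⟨b, c, hb, hc, h⟩ := hα
  refine ⟨b, c, hb, hc, fun r R hr hr1 hrR hRb => ?_⟩
  have hr' : r < 1 := by
    by_contra hcon
    push Not at hcon
    have : r ^ (1 - δ') ≤ r ^ (1 : ℝ) :=
      NNReal.rpow_le_rpow_of_exponent_le hcon (by linarith [hδ'.1])
    rw [NNReal.rpow_one] at this
    exact absurd hr1 (not_lt.mpr this)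
  refine h r R hr ?_ ?_ hRb
  · have : r ^ (1 : ℝ) < r ^ (1 - δ) :=
      NNReal.rpow_lt_rpow_of_exponent_gt hr hr' (by linarith [hδ.1])
    rwa [NNReal.rpow_one] at this
  · exact (NNReal.rpow_le_rpow_of_exponent_ge hr hr'.le (by linarith)).trans hrR

/-- The limit that defines the quasi-Assouad dimension always exists. -/
lemma tendsto_hExponent (X : Type*) [PseudoMetricSpace X] :
    Tendsto (hExponent X) (𝓝[>] (0 : ℝ)) (𝓝 (qaDim X)) := by
  refine tendsto_nhds_limUnder ⟨sSup (hExponent X '' Ioo 0 1), ?_⟩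
  exact (hExponent_antitoneOn X).tendsto_nhdsWithin_Ioo_right
    (nonempty_Ioo.mpr zero_lt_one) (OrderTop.bddAbove _)

/-- The numerical data of a Moran structure: for every level `k ≥ 1` an integer `n k ≥ 2` and
contraction ratios `c k 1, …, c k (n k)` in `(0, 1)`.  The other values of `n` and `c` play
no role. -/
structure MoranData where
  n : ℕ → ℕ
  c : ℕ → ℕ → ℝ
  two_le_n : ∀ k, 1 ≤ k → 2 ≤ n k
  c_pos : ∀ k j, 1 ≤ k → 1 ≤ j → j ≤ n k → 0 < c k j
  c_lt_one : ∀ k j, 1 ≤ k → 1 ≤ j → j ≤ n k → c k j < 1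

namespace MoranData

variable (M : MoranData)

/-- The set `D^k` of the words `i_1 ⋯ i_k` with `1 ≤ i_t ≤ n_t` for all `t`
(the `t`-th letter is the entry of the list at position `t - 1`). -/
def words (k : ℕ) : Set (List ℕ) :=
  {σ | σ.length = k ∧ ∀ (t : ℕ) (ht : t < σ.length), 1 ≤ σ[t] ∧ σ[t] ≤ M.n (t + 1)}

/-- `Δ_{p,q}(s) = ∏_{i=p}^{q} ∑_{j=1}^{n_i} c_{i,j}^s`. -/
def delta (p q : ℕ) (s : ℝ) : ℝ :=
  ∏ i ∈ Finset.Icc p q, ∑ j ∈ Finset.Icc 1 (M.n i), M.c i j ^ s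

/-- The exponent `s_{p,q}`: the positive solution of `Δ_{p,q}(s) = 1`.  For `1 ≤ p ≤ q` it exists
and is unique, see `existsUnique_delta_eq_one` and `exponent_spec`. -/
def exponent (p q : ℕ) : ℝ :=
  sInf {s : ℝ | 0 < s ∧ M.delta p q s = 1}

lemma existsUnique_delta_eq_one {p q : ℕ} (hp : 1 ≤ p) (hpq : p ≤ q) :
    ∃! s : ℝ, 0 < s ∧ M.delta p q s = 1 := by
  have hne : (Finset.Icc p q).Nonempty := Finset.nonempty_Icc.mpr hpq
  have hk : ∀ i ∈ Finset.Icc p q, 1 ≤ i := fun i hi => hp.trans (Finset.mem_Icc.mp hi).1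
  have hpos : ∀ i ∈ Finset.Icc p q, ∀ j ∈ Finset.Icc 1 (M.n i), 0 < M.c i j := fun i hi j hj =>
    M.c_pos i j (hk i hi) (Finset.mem_Icc.mp hj).1 (Finset.mem_Icc.mp hj).2
  have hlt : ∀ i ∈ Finset.Icc p q, ∀ j ∈ Finset.Icc 1 (M.n i), M.c i j < 1 := fun i hi j hj =>
    M.c_lt_one i j (hk i hi) (Finset.mem_Icc.mp hj).1 (Finset.mem_Icc.mp hj).2
  have hnei : ∀ i ∈ Finset.Icc p q, (Finset.Icc 1 (M.n i)).Nonempty := fun i hi =>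
    Finset.nonempty_Icc.mpr (by have := M.two_le_n i (hk i hi); omega)
  have hanti : StrictAnti (M.delta p q) := by
    intro s t hst
    refine Finset.prod_lt_prod_of_nonempty (fun i hi => ?_) (fun i hi => ?_) hne
    · exact Finset.sum_pos (fun j hj => Real.rpow_pos_of_pos (hpos i hi j hj) _) (hnei i hi)
    · exact Finset.sum_lt_sum_of_nonempty (hnei i hi) fun j hj =>
        Real.rpow_lt_rpow_of_exponent_gt (hpos i hi j hj) (hlt i hi j hj) hst
  have hcont : Continuous (M.delta p q) := by
    refine continuous_finsetProd _ fun i hi => continuous_finsetSum _ fun j hj => ?_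
    exact Real.continuous_const_rpow (hpos i hi j hj).ne'
  have hzero : 1 < M.delta p q 0 := by
    have : ∏ _i ∈ Finset.Icc p q, (1 : ℝ) < M.delta p q 0 := by
      refine Finset.prod_lt_prod_of_nonempty (fun _ _ => one_pos) (fun i hi => ?_) hne
      have h2 := M.two_le_n i (hk i hi)
      simp only [Real.rpow_zero, Finset.sum_const, Nat.card_Icc, nsmul_eq_mul, mul_one]
      exact_mod_cast (by omega : 1 < M.n i + 1 - 1)
    simpa using this
  have hlim : Tendsto (M.delta p q) atTop (𝓝 0) := by
    have h0 : ∏ i ∈ Finset.Icc p q, ∑ _j ∈ Finset.Icc 1 (M.n i), (0 : ℝ) = 0 := by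
      simp only [Finset.sum_const_zero]
      exact Finset.prod_eq_zero hne.choose_spec rfl
    rw [← h0]
    refine tendsto_finsetProd _ fun i hi => tendsto_finsetSum _ fun j hj => ?_
    exact tendsto_rpow_atTop_of_base_lt_one _ (by linarith [hpos i hi j hj]) (hlt i hi j hj)
  obtain ⟨T, hT1, hT0⟩ := ((hlim.eventually (gt_mem_nhds one_pos)).and
    (eventually_gt_atTop (0 : ℝ))).exists
  obtain ⟨s, hs, hs1⟩ := intermediate_value_Icc' hT0.le hcont.continuousOn ⟨hT1.le, hzero.le⟩
  refine ⟨s, ⟨lt_of_le_of_ne hs.1 ?_, hs1⟩, fun t ht => hanti.injective (ht.2.trans hs1.symm)⟩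
  rintro rfl
  exact hzero.ne' hs1

lemma exponent_spec {p q : ℕ} (hp : 1 ≤ p) (hpq : p ≤ q) :
    0 < M.exponent p q ∧ M.delta p q (M.exponent p q) = 1 := by
  obtain ⟨s, hs, huniq⟩ := M.existsUnique_delta_eq_one hp hpq
  have : {s : ℝ | 0 < s ∧ M.delta p q s = 1} = {s} :=
    Set.eq_singleton_iff_unique_mem.mpr ⟨hs, huniq⟩
  rw [exponent, this, csInf_singleton]
  exact hs

/-- `E` is a (general) Moran set in `ℝ^d` with initial set `J` and data `M`, that is,
`E ∈ 𝓜(J, {n_k}, {c_{k,j}})`: there are basic sets `I σ` (`σ` a word), all geometrically similar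
to `J`, such that the children `I (σ ++ [j])` of `I σ` are contained in `I σ`, have pairwise
disjoint interiors and diameter ratios `c_{k,j}`, and `E = ⋂_k ⋃_{σ ∈ D^k} I σ`. -/
def IsMoranSet {d : ℕ} (J E : Set (EuclideanSpace ℝ (Fin d))) : Prop :=
  ∃ I : List ℕ → Set (EuclideanSpace ℝ (Fin d)),
    I [] = J ∧
    (∀ k, ∀ σ ∈ M.words k,
      ∃ f : EuclideanSpace ℝ (Fin d) ≃ᵈ EuclideanSpace ℝ (Fin d), I σ = f '' J) ∧
    (∀ k, ∀ σ ∈ M.words k, ∀ j, 1 ≤ j → j ≤ M.n (k + 1) → I (σ ++ [j]) ⊆ I σ) ∧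
    (∀ k, ∀ σ ∈ M.words k, ∀ i j, 1 ≤ i → i ≤ M.n (k + 1) → 1 ≤ j → j ≤ M.n (k + 1) → i ≠ j →
      Disjoint (interior (I (σ ++ [i]))) (interior (I (σ ++ [j])))) ∧
    (∀ k, ∀ σ ∈ M.words k, ∀ j, 1 ≤ j → j ≤ M.n (k + 1) →
      Metric.diam (I (σ ++ [j])) / Metric.diam (I σ) = M.c (k + 1) j) ∧
    E = ⋂ k : ℕ, ⋃ σ ∈ M.words k, I σ

/-- `max_{1 ≤ p ≤ q(1-η)} s_{p,q}` (the index set is finite; the value is `0` if it is empty,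
which happens for only finitely many `q` once `0 < η < 1`). -/
def maxExponent (η : ℝ) (q : ℕ) : ℝ≥0∞ :=
  ⨆ (p : ℕ) (_ : 1 ≤ p ∧ (p : ℝ) ≤ q * (1 - η)), ENNReal.ofReal (M.exponent p q)

end MoranData

end

/-!
The diameters satisfy `∑ |I_τ|^s = |I_σ|^s Δ_{k+1,k+n}(s)`, where `τ` runs over the words that
prolong a word `σ` of length `k` by `n` letters (`sum_size_rpow`). Comparing volumes of interiors
shows that all ratios lie in an interval `[c₀, c₁]` with `c₁ < 1` (`exists_ratioBounds`), so that
levels and logarithms of diameters are proportional up to constants, and that a ball meets boundedly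
many non-overlapping basic sets of comparable size (`exists_packing_bound`). Hence `N_{r,R}` is
comparable to the number of basic sets of diameter about `r` inside one of diameter about `R`, and
the condition `r ^ (1 - δ) ≤ R` says that a fixed proportion of the first `q` levels lies between
the two scales, as does `p ≤ q (1 - η)`.

Let `h(δ)` be the exponent in the definition of the quasi-Assouad dimension and let `L(η)` be the
`limsup` in the claim. Both are nonincreasing, so their limits at `0+` are suprema, and it suffices
to bound each value of one by a value of the other.

* `exists_hExponent_le_limsup`: for `s > L(η)` one has `Δ_{p,q}(s) ≤ 1` at all relevant levels. The
  basic sets of diameter about `r` inside `I_σ` belong to different levels `k + n`, and at each one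
  their moment of order `s + e` is at most `c₁ ^ (e n) |I_σ| ^ (s + e)`; the geometric sum over `n`
  bounds their number by a multiple of `(R / r) ^ (s + e)`.
* `exists_limsup_le_hExponent`: if `α < t < L(η)` and `α` is admissible for `h(δ)`, then the
  descendants of `σ` of level `q` whose diameter is about `r = c₁ ^ m |I_σ|` number at most a
  multiple of `c₁ ^ (-m α)`. Their `t`-th moments form a geometric series in `m ≥ n`, where `n` is
  the number of levels passed, so `Δ_{p,q}(t)` is small when `n` is large. But `Δ_{p,q}(t) ≥ 1` for
  infinitely many `q` and some `p ≤ q (1 - η)`; replacing `p` by `p + K` ensures that `|I_σ|` is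
  below the bound on the radii, and costs only a constant factor.
-/

/-! ### Words and their descendants -/

namespace MoranData

section Words

variable {M : MoranData}

theorem nil_mem_words : [] ∈ M.words 0 := ⟨rfl, fun t ht => by simp at ht⟩

theorem take_mem_words {k i : ℕ} {τ : List ℕ} (h : τ ∈ M.words k) (hi : i ≤ k) :
    τ.take i ∈ M.words i := by
  refine ⟨by simp [h.1, hi], fun t ht => ?_⟩
  rw [List.getElem_take]
  exact h.2 t (by simp at ht; omega)

theorem append_mem_words {k j : ℕ} {σ : List ℕ} (hσ : σ ∈ M.words k) (h1 : 1 ≤ j)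
    (h2 : j ≤ M.n (k + 1)) : σ ++ [j] ∈ M.words (k + 1) := by
  refine ⟨by simp [hσ.1], fun t ht => ?_⟩
  by_cases h : t < σ.length
  · rw [List.getElem_append_left h]
    exact hσ.2 t h
  · have hlen := hσ.1
    have : t = k := by simp at ht; omega
    subst this
    rw [List.getElem_append_right (by omega)]
    simpa using ⟨h1, h2⟩

theorem exists_append_of_mem_words_succ {k : ℕ} {τ : List ℕ} (h : τ ∈ M.words (k + 1)) :
    ∃ σ ∈ M.words k, ∃ j, 1 ≤ j ∧ j ≤ M.n (k + 1) ∧ τ = σ ++ [j] := by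
  have hlen := h.1
  have hlast := h.2 k (by omega)
  refine ⟨τ.take k, take_mem_words h (by omega), τ[k], hlast.1, hlast.2, ?_⟩
  rw [← List.take_succ_eq_append_getElem, List.take_of_length_le hlen.le]

theorem words_nonempty (k : ℕ) : (M.words k).Nonempty := by
  induction k with
  | zero => exact ⟨[], nil_mem_words⟩
  | succ k ih =>
    obtain ⟨σ, hσ⟩ := ih
    exact ⟨_, append_mem_words hσ le_rfl (by have := M.two_le_n (k + 1) (by omega); omega)⟩

variable (M) in
/-- The words obtained from `σ` by appending `n` admissible letters, as a finite set. -/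
def descendants (σ : List ℕ) : ℕ → Finset (List ℕ)
  | 0 => {σ}
  | n + 1 => (descendants σ n).biUnion fun τ =>
      (Finset.Icc 1 (M.n (σ.length + n + 1))).image fun j => τ ++ [j]

theorem mem_descendants {k n : ℕ} {σ τ : List ℕ} (hσ : σ ∈ M.words k) :
    τ ∈ M.descendants σ n ↔ τ ∈ M.words (k + n) ∧ σ <+: τ := by
  induction n generalizing τ with
  | zero =>
    simp only [descendants, Finset.mem_singleton, add_zero]
    constructor
    · rintro rfl
      exact ⟨hσ, List.prefix_rfl⟩
    · rintro ⟨h, hp⟩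
      exact (hp.eq_of_length (by rw [hσ.1, h.1])).symm
  | succ n ih =>
    simp only [descendants, Finset.mem_biUnion, Finset.mem_image, Finset.mem_Icc, ih, hσ.1]
    constructor
    · rintro ⟨τ, ⟨hτ, hp⟩, j, ⟨h1, h2⟩, rfl⟩
      exact ⟨append_mem_words hτ h1 h2, hp.trans (List.prefix_append _ _)⟩
    · rintro ⟨hτ, hp⟩
      obtain ⟨τ', hτ', j, h1, h2, rfl⟩ := exists_append_of_mem_words_succ (k := k + n) hτ
      refine ⟨τ', ⟨hτ', ?_⟩, j, ⟨h1, h2⟩, rfl⟩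
      exact List.prefix_of_prefix_length_le hp (List.prefix_append _ _)
        (by rw [hσ.1, hτ'.1]; omega)

theorem sum_descendants_succ {σ : List ℕ} {n : ℕ} (g : List ℕ → ℝ) :
    ∑ τ ∈ M.descendants σ (n + 1), g τ = ∑ τ ∈ M.descendants σ n,
      ∑ j ∈ Finset.Icc 1 (M.n (σ.length + n + 1)), g (τ ++ [j]) := by
  rw [descendants, Finset.sum_biUnion]
  · refine Finset.sum_congr rfl fun τ _ => Finset.sum_image fun i _ j _ h => ?_
    simpa using h
  · intro τ _ τ' _ hne
    refine Finset.disjoint_left.mpr fun ρ h h' => hne ?_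
    obtain ⟨i, -, rfl⟩ := Finset.mem_image.mp h
    obtain ⟨j, -, hj⟩ := Finset.mem_image.mp h'
    exact (List.append_inj' hj rfl).1.symm

end Words

/-! ### The products `Δ_{p,q}` -/

/-- All contraction ratios lie in `[c₀, c₁]`, where `0 < c₀` and `c₁ < 1`. -/
structure RatioBounds (M : MoranData) (c₀ c₁ : ℝ) : Prop where
  pos : 0 < c₀
  lt_one : c₁ < 1
  lower : ∀ k j, 1 ≤ k → 1 ≤ j → j ≤ M.n k → c₀ ≤ M.c k j
  upper : ∀ k j, 1 ≤ k → 1 ≤ j → j ≤ M.n k → M.c k j ≤ c₁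

theorem RatioBounds.le {M : MoranData} {c₀ c₁ : ℝ} (h : M.RatioBounds c₀ c₁) : c₀ ≤ c₁ := by
  have h2 := M.two_le_n 1 le_rfl
  exact (h.lower 1 1 le_rfl le_rfl (by omega)).trans (h.upper 1 1 le_rfl le_rfl (by omega))

section Delta

variable {M : MoranData}

theorem delta_pos {p q : ℕ} (hp : 1 ≤ p) (s : ℝ) : 0 < M.delta p q s := by
  refine Finset.prod_pos fun i hi => Finset.sum_pos (fun j hj => ?_) ?_
  · rw [Finset.mem_Icc] at hi hj
    exact Real.rpow_pos_of_pos (M.c_pos i j (hp.trans hi.1) hj.1 hj.2) _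
  · rw [Finset.mem_Icc] at hi
    exact Finset.nonempty_Icc.mpr (by have := M.two_le_n i (hp.trans hi.1); omega)

theorem delta_antitone {p q : ℕ} (hp : 1 ≤ p) : Antitone (M.delta p q) := by
  intro s t hst
  refine Finset.prod_le_prod (fun i hi => Finset.sum_nonneg fun j hj => ?_)
    fun i hi => Finset.sum_le_sum fun j hj => ?_
  all_goals
    rw [Finset.mem_Icc] at hi hj
    have h0 := M.c_pos i j (hp.trans hi.1) hj.1 hj.2
  · exact Real.rpow_nonneg h0.le _
  · exact Real.rpow_le_rpow_of_exponent_ge h0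
      (M.c_lt_one i j (hp.trans hi.1) hj.1 hj.2).le hst

theorem delta_le_one {p q : ℕ} (hp : 1 ≤ p) (hpq : p ≤ q) {s : ℝ} (hs : M.exponent p q ≤ s) :
    M.delta p q s ≤ 1 :=
  (delta_antitone hp hs).trans (M.exponent_spec hp hpq).2.le

theorem one_le_delta {p q : ℕ} (hp : 1 ≤ p) (hpq : p ≤ q) {s : ℝ} (hs : s ≤ M.exponent p q) :
    1 ≤ M.delta p q s :=
  (M.exponent_spec hp hpq).2.ge.trans (delta_antitone hp hs)

theorem delta_succ {p q : ℕ} (hpq : p ≤ q + 1) (s : ℝ) :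
    M.delta p (q + 1) s = M.delta p q s * ∑ j ∈ Finset.Icc 1 (M.n (q + 1)), M.c (q + 1) j ^ s :=
  Finset.prod_Icc_succ_top hpq _

theorem delta_split {p m q : ℕ} (hpm : p ≤ m + 1) (hmq : m ≤ q) (s : ℝ) :
    M.delta p q s = M.delta p m s * M.delta (m + 1) q s := by
  induction q, hmq using Nat.le_induction with
  | base => simp [delta]
  | succ q hq ih => rw [delta_succ (by omega), ih, delta_succ (by omega), mul_assoc]

theorem delta_le_pow {A s : ℝ}
    (hA : ∀ i, 1 ≤ i → ∑ j ∈ Finset.Icc 1 (M.n i), M.c i j ^ s ≤ A) (p K : ℕ) :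
    M.delta (p + 1) (p + K) s ≤ A ^ K := by
  have hcard : K = (Finset.Icc (p + 1) (p + K)).card := by rw [Nat.card_Icc]; omega
  conv_rhs => rw [hcard]
  rw [← Finset.prod_const]
  refine Finset.prod_le_prod (fun i hi => Finset.sum_nonneg fun j hj => ?_) fun i hi => ?_
  all_goals rw [Finset.mem_Icc] at hi
  · rw [Finset.mem_Icc] at hj
    exact Real.rpow_nonneg (M.c_pos i j (by omega) hj.1 hj.2).le _
  · exact hA i (by omega)

end Delta

/-! ### Geometry of the basic sets -/

/-- A choice of the basic sets `I_σ` of a Moran set with initial set `J` and data `M`. -/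
structure BasicSets (M : MoranData) {d : ℕ} (J : Set (EuclideanSpace ℝ (Fin d))) where
  set : List ℕ → Set (EuclideanSpace ℝ (Fin d))
  root : set [] = J
  similar : ∀ k, ∀ σ ∈ M.words k,
    ∃ f : EuclideanSpace ℝ (Fin d) ≃ᵈ EuclideanSpace ℝ (Fin d), set σ = f '' J
  subset : ∀ k, ∀ σ ∈ M.words k, ∀ j, 1 ≤ j → j ≤ M.n (k + 1) → set (σ ++ [j]) ⊆ set σ
  disjoint : ∀ k, ∀ σ ∈ M.words k, ∀ i j, 1 ≤ i → i ≤ M.n (k + 1) → 1 ≤ j → j ≤ M.n (k + 1) →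
    i ≠ j → Disjoint (interior (set (σ ++ [i]))) (interior (set (σ ++ [j])))
  ratio : ∀ k, ∀ σ ∈ M.words k, ∀ j, 1 ≤ j → j ≤ M.n (k + 1) →
    Metric.diam (set (σ ++ [j])) / Metric.diam (set σ) = M.c (k + 1) j

namespace BasicSets

variable {M : MoranData} {d : ℕ} {J : Set (EuclideanSpace ℝ (Fin d))} (B : M.BasicSets J)

/-- The Moran set `⋂_k ⋃_{σ ∈ D^k} I_σ` of a system of basic sets. -/
def limitSet : Set (EuclideanSpace ℝ (Fin d)) := ⋂ k : ℕ, ⋃ σ ∈ M.words k, B.set σ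

/-- The diameter `|I_σ|`. -/
noncomputable def size (σ : List ℕ) : ℝ := Metric.diam (B.set σ)

theorem size_nonneg (σ : List ℕ) : 0 ≤ B.size σ := Metric.diam_nonneg

theorem isCompact_set (hJ : IsCompact J) {k : ℕ} {σ : List ℕ} (hσ : σ ∈ M.words k) :
    IsCompact (B.set σ) := by
  obtain ⟨f, hf⟩ := B.similar k σ hσ
  rw [hf]
  exact hJ.image f.toHomeomorph.continuous

theorem set_nonempty (hJ : J.Nonempty) {k : ℕ} {σ : List ℕ} (hσ : σ ∈ M.words k) :
    (B.set σ).Nonempty := by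
  obtain ⟨f, hf⟩ := B.similar k σ hσ
  rw [hf]
  exact hJ.image f

theorem set_subset_take {k i : ℕ} {τ : List ℕ} (hτ : τ ∈ M.words k) (hi : i ≤ k) :
    B.set τ ⊆ B.set (τ.take i) := by
  induction k generalizing τ with
  | zero =>
    rw [List.take_of_length_le (by rw [hτ.1]; omega)]
  | succ k ih =>
    rcases hi.lt_or_eq with h | rfl
    · obtain ⟨σ, hσ, j, h1, h2, rfl⟩ := exists_append_of_mem_words_succ hτ
      rw [List.take_append_of_le_length (by rw [hσ.1]; omega)]
      exact (B.subset k σ hσ j h1 h2).trans (ih hσ (by omega))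
    · rw [List.take_of_length_le hτ.1.le]

theorem set_subset_of_mem_descendants {k n : ℕ} {σ τ : List ℕ} (hσ : σ ∈ M.words k)
    (hτ : τ ∈ M.descendants σ n) : B.set τ ⊆ B.set σ := by
  obtain ⟨h, hp⟩ := (mem_descendants hσ).mp hτ
  have := B.set_subset_take h (Nat.le_add_right k n)
  rwa [← hσ.1, ← List.prefix_iff_eq_take.mp hp] at this

theorem disjoint_interior_of_length_eq {k : ℕ} {σ τ : List ℕ} (hσ : σ ∈ M.words k)
    (hτ : τ ∈ M.words k) (hne : σ ≠ τ) : Disjoint (interior (B.set σ)) (interior (B.set τ)) := by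
  induction k generalizing σ τ with
  | zero =>
    exact absurd ((List.length_eq_zero_iff.mp hσ.1).trans (List.length_eq_zero_iff.mp hτ.1).symm)
      hne
  | succ k ih =>
    obtain ⟨σ, hσ', i, hi1, hi2, rfl⟩ := exists_append_of_mem_words_succ hσ
    obtain ⟨τ, hτ', j, hj1, hj2, rfl⟩ := exists_append_of_mem_words_succ hτ
    by_cases h : σ = τ
    · subst h
      exact B.disjoint k σ hσ' i j hi1 hi2 hj1 hj2 (by rintro rfl; exact hne rfl)
    · exact (ih hσ' hτ' h).mono (interior_mono (B.subset k σ hσ' i hi1 hi2))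
        (interior_mono (B.subset k τ hτ' j hj1 hj2))

/-- Every basic set meets the Moran set: follow the first child forever. -/
theorem inter_limitSet_nonempty (hJ : IsCompact J) (hJne : J.Nonempty) {k : ℕ} {σ : List ℕ}
    (hσ : σ ∈ M.words k) : (B.set σ ∩ B.limitSet).Nonempty := by
  have hw : ∀ n, σ ++ List.replicate n 1 ∈ M.words (k + n) := by
    intro n
    induction n with
    | zero => simpa using hσ
    | succ n ih =>
      rw [List.replicate_succ', ← List.append_assoc]
      exact append_mem_words (k := k + n) ih le_rfl
        (by have := M.two_le_n (k + n + 1) (by omega); omega)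
  have hanti : ∀ n, B.set (σ ++ List.replicate (n + 1) 1) ⊆ B.set (σ ++ List.replicate n 1) := by
    intro n
    rw [List.replicate_succ', ← List.append_assoc]
    exact B.subset (k + n) _ (hw n) 1 le_rfl (by have := M.two_le_n (k + n + 1) (by omega); omega)
  obtain ⟨x, hx⟩ := IsCompact.nonempty_iInter_of_sequence_nonempty_isCompact_isClosed
    (fun n => B.set (σ ++ List.replicate n 1)) hanti (fun n => B.set_nonempty hJne (hw n))
    (B.isCompact_set hJ (hw 0)) (fun n => (B.isCompact_set hJ (hw n)).isClosed)
  rw [mem_iInter] at hx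
  refine ⟨x, by simpa using hx 0, mem_iInter.mpr fun m => mem_iUnion₂.mpr ?_⟩
  exact ⟨_, take_mem_words (hw m) (Nat.le_add_left m k),
    B.set_subset_take (hw m) (Nat.le_add_left m k) (hx m)⟩

section Size

variable (hJ : IsCompact J) (hJint : (interior J).Nonempty) (hd : 1 ≤ d)

include hJ hJint hd in
theorem diam_pos : 0 < Metric.diam J := by
  have : Nonempty (Fin d) := ⟨⟨0, hd⟩⟩
  obtain ⟨x, hx⟩ := hJint
  obtain ⟨ε, hε, hb⟩ := Metric.isOpen_iff.mp isOpen_interior x hx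
  obtain ⟨y, hy⟩ := exists_ne (0 : EuclideanSpace ℝ (Fin d))
  have hy0 : 0 < ‖y‖ := norm_pos_iff.mpr hy
  have hz : x + (ε / 2 / ‖y‖) • y ∈ J := by
    refine interior_subset (hb ?_)
    rw [Metric.mem_ball, dist_self_add_left, norm_smul, Real.norm_of_nonneg (by positivity),
      div_mul_cancel₀ _ hy0.ne']
    linarith
  refine lt_of_lt_of_le ?_ (Metric.dist_le_diam_of_mem hJ.isBounded hz (interior_subset hx))
  rw [dist_self_add_left]
  exact norm_pos_iff.mpr (smul_ne_zero (by positivity) hy)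

variable (hJ0 : 0 < Metric.diam J)

include hJ0 in
theorem size_pos {k : ℕ} {σ : List ℕ} (hσ : σ ∈ M.words k) : 0 < B.size σ := by
  obtain ⟨f, hf⟩ := B.similar k σ hσ
  rw [size, hf, Dilation.diam_image]
  exact mul_pos (Dilation.ratio_pos f) hJ0

include hJ0 in
theorem size_append {k j : ℕ} {σ : List ℕ} (hσ : σ ∈ M.words k) (h1 : 1 ≤ j)
    (h2 : j ≤ M.n (k + 1)) : B.size (σ ++ [j]) = B.size σ * M.c (k + 1) j := by
  have h : B.size (σ ++ [j]) / B.size σ = _ := B.ratio k σ hσ j h1 h2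
  rw [div_eq_iff (B.size_pos hJ0 hσ).ne'] at h
  rw [h, mul_comm]

include hJ0 in
/-- The moment sum of the diameters over the descendants of `σ` is governed by `Δ`. -/
theorem sum_size_rpow {k n : ℕ} {σ : List ℕ} (hσ : σ ∈ M.words k) (s : ℝ) :
    ∑ τ ∈ M.descendants σ n, B.size τ ^ s = B.size σ ^ s * M.delta (k + 1) (k + n) s := by
  induction n with
  | zero => simp [descendants, delta]
  | succ n ih =>
    rw [sum_descendants_succ, ← add_assoc, delta_succ (by omega), ← mul_assoc, ← ih,
      Finset.sum_mul]
    refine Finset.sum_congr rfl fun τ hτ => ?_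
    have hτ := ((mem_descendants hσ).mp hτ).1
    rw [hσ.1, Finset.mul_sum]
    refine Finset.sum_congr rfl fun j hj => ?_
    rw [Finset.mem_Icc] at hj
    rw [B.size_append hJ0 hτ hj.1 hj.2, Real.mul_rpow (B.size_nonneg τ)
      (M.c_pos _ _ (by omega) hj.1 hj.2).le]

variable {c₀ c₁ : ℝ} (hc : M.RatioBounds c₀ c₁)

include hJ0 hc in
theorem size_descendants {k n : ℕ} {σ τ : List ℕ} (hσ : σ ∈ M.words k)
    (hτ : τ ∈ M.descendants σ n) :
    c₀ ^ n * B.size σ ≤ B.size τ ∧ B.size τ ≤ c₁ ^ n * B.size σ := by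
  induction n generalizing τ with
  | zero =>
    rw [descendants, Finset.mem_singleton] at hτ
    simp [hτ]
  | succ n ih =>
    obtain ⟨h, hp⟩ := (mem_descendants hσ).mp hτ
    obtain ⟨τ, hτ', j, h1, h2, rfl⟩ := exists_append_of_mem_words_succ (k := k + n) h
    have hmem : τ ∈ M.descendants σ n := (mem_descendants hσ).mpr ⟨hτ',
      List.prefix_of_prefix_length_le hp (List.prefix_append _ _) (by rw [hσ.1, hτ'.1]; omega)⟩
    obtain ⟨hl, hu⟩ := ih hmem
    have hlo := hc.lower (k + n + 1) j (by omega) h1 h2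
    have hup := hc.upper (k + n + 1) j (by omega) h1 h2
    have h0 := B.size_nonneg τ
    rw [B.size_append hJ0 hτ' h1 h2]
    constructor
    · calc c₀ ^ (n + 1) * B.size σ = (c₀ ^ n * B.size σ) * c₀ := by ring
        _ ≤ _ := mul_le_mul hl hlo hc.pos.le h0
    · calc _ ≤ B.size τ * c₁ := mul_le_mul_of_nonneg_left hup h0
        _ ≤ (c₁ ^ n * B.size σ) * c₁ := mul_le_mul_of_nonneg_right hu (hc.pos.le.trans hc.le)
        _ = _ := by ring

include hJ0 hc in
theorem size_words {k : ℕ} {σ : List ℕ} (hσ : σ ∈ M.words k) :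
    c₀ ^ k * Metric.diam J ≤ B.size σ ∧ B.size σ ≤ c₁ ^ k * Metric.diam J := by
  have := B.size_descendants hJ0 hc (σ := []) (n := k) nil_mem_words
    ((mem_descendants nil_mem_words).mpr ⟨by simpa using hσ, List.nil_prefix⟩)
  rwa [size, B.root] at this

theorem size_le_size_take (hJ : IsCompact J) {k i : ℕ} {τ : List ℕ} (hτ : τ ∈ M.words k)
    (hi : i ≤ k) : B.size τ ≤ B.size (τ.take i) :=
  Metric.diam_mono (B.set_subset_take hτ hi)
    (B.isCompact_set hJ (take_mem_words hτ hi)).isBounded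

end Size

/-! ### Volume estimates -/

open MeasureTheory in
/-- Similarities scale Hausdorff measure, hence the volume of the interior of `I_σ` is that of the
interior of `J` times the `d`-th power of the similarity ratio. -/
theorem measureReal_interior {μ : Measure (EuclideanSpace ℝ (Fin d))}
    (hμ : μ = Measure.hausdorffMeasure (d : ℝ)) (hJ0 : 0 < Metric.diam J) {k : ℕ} {σ : List ℕ}
    (hσ : σ ∈ M.words k) :
    μ.real (interior (B.set σ)) = (B.size σ / Metric.diam J) ^ d * μ.real (interior J) := by
  obtain ⟨f, hf⟩ := B.similar k σ hσ
  have hsize : B.size σ / Metric.diam J = Dilation.ratio f := by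
    rw [size, hf, Dilation.diam_image, mul_div_cancel_right₀ _ hJ0.ne']
  have hint : interior (B.set σ) = f '' interior J := by
    rw [hf]
    exact (f.toHomeomorph.image_interior J).symm
  have hd : (0 : ℝ) ≤ d := Nat.cast_nonneg d
  have key : μ (f '' interior J) = (Dilation.ratio f : ℝ≥0∞) ^ (d : ℝ) * μ (interior J) := by
    subst hμ
    refine le_antisymm ((Dilation.lipschitz f).hausdorffMeasure_image_le hd _) ?_
    have h := (Dilation.antilipschitz f).le_hausdorffMeasure_image hd (interior J)
    have hr : ((Dilation.ratio f : ℝ≥0) : ℝ≥0∞) ≠ 0 := by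
      simpa using Dilation.ratio_ne_zero f
    rw [ENNReal.coe_inv (Dilation.ratio_ne_zero f), ENNReal.inv_rpow] at h
    rwa [mul_comm, ← ENNReal.le_div_iff_mul_le, ENNReal.div_eq_inv_mul]
    · exact Or.inl (ENNReal.rpow_pos (pos_iff_ne_zero.mpr hr) ENNReal.coe_ne_top).ne'
    · left; simp
  rw [hsize, hint, measureReal_def, key, ENNReal.toReal_mul, measureReal_def]
  simp

open MeasureTheory in
theorem isAddHaarMeasure_hausdorff (d : ℕ) :
    (Measure.hausdorffMeasure (d : ℝ) : Measure (EuclideanSpace ℝ (Fin d))).IsAddHaarMeasure := by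
  simpa using isAddHaarMeasure_hausdorffMeasure (E := EuclideanSpace ℝ (Fin d))

open MeasureTheory in
theorem measureReal_interior_pos {μ : Measure (EuclideanSpace ℝ (Fin d))} [μ.IsAddHaarMeasure]
    (hJ : IsCompact J) (hJint : (interior J).Nonempty) : 0 < μ.real (interior J) :=
  ENNReal.toReal_pos (isOpen_interior.measure_pos μ hJint).ne'
    ((measure_mono interior_subset).trans_lt hJ.measure_lt_top).ne

open MeasureTheory in
include B in
/-- Comparing volumes of the interiors of a basic set and of its children. -/
theorem sum_ratio_pow_le_one (hJ : IsCompact J) (hJint : (interior J).Nonempty)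
    (hJ0 : 0 < Metric.diam J) {k : ℕ} (hk : 1 ≤ k) :
    ∑ j ∈ Finset.Icc 1 (M.n k), M.c k j ^ d ≤ 1 := by
  obtain ⟨k, rfl⟩ : ∃ l, k = l + 1 := ⟨k - 1, by omega⟩
  obtain ⟨σ, hσ⟩ := words_nonempty (M := M) k
  obtain ⟨μ, hμ⟩ : ∃ μ : Measure (EuclideanSpace ℝ (Fin d)),
    μ = Measure.hausdorffMeasure (d : ℝ) := ⟨_, rfl⟩
  have : μ.IsAddHaarMeasure := hμ ▸ isAddHaarMeasure_hausdorff d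
  have hm : 0 < μ.real (interior J) := measureReal_interior_pos hJ hJint
  have hsize := B.size_pos hJ0 hσ
  have hfin : μ (interior (B.set σ)) ≠ ∞ :=
    ((measure_mono interior_subset).trans_lt (B.isCompact_set hJ hσ).measure_lt_top).ne
  have hsum : ∑ j ∈ Finset.Icc 1 (M.n (k + 1)), μ.real (interior (B.set (σ ++ [j]))) ≤
      μ.real (interior (B.set σ)) := by
    rw [← measureReal_biUnion_finset ?_ ?_ ?_]
    · refine measureReal_mono (iUnion₂_subset fun j hj => ?_) hfin
      rw [Finset.mem_Icc] at hj
      exact interior_mono (B.subset k σ hσ j hj.1 hj.2)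
    · intro i hi j hj hne
      rw [Finset.mem_coe, Finset.mem_Icc] at hi hj
      exact B.disjoint k σ hσ i j hi.1 hi.2 hj.1 hj.2 hne
    · exact fun j _ => isOpen_interior.measurableSet
    · intro j hj
      rw [Finset.mem_Icc] at hj
      exact ((measure_mono interior_subset).trans_lt
        (B.isCompact_set hJ (append_mem_words hσ hj.1 hj.2)).measure_lt_top).ne
  have hV : 0 < (B.size σ / Metric.diam J) ^ d * μ.real (interior J) := by positivity
  rw [B.measureReal_interior hμ hJ0 hσ] at hsum
  refine le_of_mul_le_mul_right ?_ hV
  rw [one_mul, Finset.sum_mul]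
  refine (Finset.sum_congr rfl fun j hj => ?_).trans_le hsum
  rw [Finset.mem_Icc] at hj
  rw [B.measureReal_interior hμ hJ0 (append_mem_words hσ hj.1 hj.2),
    B.size_append hJ0 hσ hj.1 hj.2, mul_div_right_comm, mul_pow]
  ring

include B in
/-- A lower bound for the ratios forces an upper bound below `1`, since every basic set has at
least two children, whose volumes add up to at most that of the parent. -/
theorem exists_ratioBounds (hJ : IsCompact J) (hJint : (interior J).Nonempty)
    (hJ0 : 0 < Metric.diam J) (hd : 1 ≤ d) {c₀ : ℝ} (h0 : 0 < c₀)
    (hc : ∀ k j, 1 ≤ k → 1 ≤ j → j ≤ M.n k → c₀ ≤ M.c k j) : ∃ c₁, M.RatioBounds c₀ c₁ := by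
  have hd0 : (0 : ℝ) < d := by exact_mod_cast hd
  refine ⟨1 - c₀ ^ d / d, h0, by have : 0 < c₀ ^ d / d := by positivity
                                 linarith, hc, fun k j hk h1 h2 => ?_⟩
  have h2n := M.two_le_n k hk
  obtain ⟨i, hi1, hi2, hij⟩ : ∃ i, 1 ≤ i ∧ i ≤ M.n k ∧ i ≠ j := by
    by_cases h : j = 1
    · exact ⟨2, by omega, h2n, by omega⟩
    · exact ⟨1, by omega, by omega, by omega⟩
  have hsub : ({i, j} : Finset ℕ) ⊆ Finset.Icc 1 (M.n k) := by
    intro l hl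
    rw [Finset.mem_insert, Finset.mem_singleton] at hl
    rw [Finset.mem_Icc]
    rcases hl with rfl | rfl <;> constructor <;> assumption
  have hsum := (Finset.sum_le_sum_of_subset_of_nonneg (f := fun j => M.c k j ^ d) hsub
    fun l hl _ => by
      rw [Finset.mem_Icc] at hl
      exact pow_nonneg (M.c_pos k l hk hl.1 hl.2).le _).trans
    (B.sum_ratio_pow_le_one hJ hJint hJ0 hk)
  rw [Finset.sum_pair hij] at hsum
  have hi : c₀ ^ d ≤ M.c k i ^ d := pow_le_pow_left₀ h0.le (hc k i hk hi1 hi2) _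
  have hB := one_add_mul_le_pow (a := M.c k j - 1) (by have := M.c_pos k j hk h1 h2; linarith) d
  rw [add_sub_cancel] at hB
  have : c₀ ^ d / d ≤ 1 - M.c k j := by
    rw [div_le_iff₀ hd0]
    linarith
  linarith

include B in
theorem exists_sum_ratio_rpow_le (hJ : IsCompact J) (hJint : (interior J).Nonempty)
    (hJ0 : 0 < Metric.diam J) {c₀ c₁ : ℝ} (hc : M.RatioBounds c₀ c₁) : ∃ A : ℝ, 0 < A ∧
      ∀ s : ℝ, 0 ≤ s → ∀ i, 1 ≤ i → ∑ j ∈ Finset.Icc 1 (M.n i), M.c i j ^ s ≤ A := by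
  have h0 : 0 < c₀ ^ d := pow_pos hc.pos d
  refine ⟨(c₀ ^ d)⁻¹, by positivity, fun s hs i hi => ?_⟩
  have hcard : ∑ j ∈ Finset.Icc 1 (M.n i), c₀ ^ d ≤ 1 := by
    refine (Finset.sum_le_sum fun j hj => ?_).trans (B.sum_ratio_pow_le_one hJ hJint hJ0 hi)
    rw [Finset.mem_Icc] at hj
    exact pow_le_pow_left₀ hc.pos.le (hc.lower i j hi hj.1 hj.2) _
  refine (Finset.sum_le_sum (g := fun _ => (1 : ℝ)) fun j hj => ?_).trans ?_
  · rw [Finset.mem_Icc] at hj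
    exact Real.rpow_le_one (M.c_pos i j hi hj.1 hj.2).le (M.c_lt_one i j hi hj.1 hj.2).le hs
  · rw [Finset.sum_const, nsmul_eq_mul] at hcard ⊢
    rw [mul_one, inv_eq_one_div, le_div_iff₀ h0]
    exact hcard

open MeasureTheory in
/-- Packing: boundedly many non-overlapping basic sets of comparable size meet a ball. -/
theorem exists_packing_bound (hJ : IsCompact J) (hJint : (interior J).Nonempty)
    (hJ0 : 0 < Metric.diam J) : ∃ κ : ℝ, 0 < κ ∧
      ∀ (F : Finset (List ℕ)) (x : EuclideanSpace ℝ (Fin d)) (R ρ D : ℝ), 0 < ρ → 0 ≤ R → 0 ≤ D →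
        (∀ σ ∈ F, ∃ k, σ ∈ M.words k) →
        (∀ σ ∈ F, ∀ τ ∈ F, σ ≠ τ → Disjoint (interior (B.set σ)) (interior (B.set τ))) →
        (∀ σ ∈ F, ρ ≤ B.size σ ∧ B.size σ ≤ D ∧ (B.set σ ∩ Metric.closedBall x R).Nonempty) →
        (F.card : ℝ) ≤ κ * ((R + D) / ρ) ^ d := by
  obtain ⟨μ, hμ⟩ : ∃ μ : Measure (EuclideanSpace ℝ (Fin d)),
    μ = Measure.hausdorffMeasure (d : ℝ) := ⟨_, rfl⟩
  have : μ.IsAddHaarMeasure := hμ ▸ isAddHaarMeasure_hausdorff d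
  have hm : 0 < μ.real (interior J) := measureReal_interior_pos hJ hJint
  have hb : 0 < μ.real (Metric.ball (0 : EuclideanSpace ℝ (Fin d)) 1) :=
    ENNReal.toReal_pos (Metric.measure_ball_pos μ _ one_pos).ne' measure_ball_lt_top.ne
  refine ⟨Metric.diam J ^ d * μ.real (Metric.ball (0 : EuclideanSpace ℝ (Fin d)) 1) /
    μ.real (interior J), by positivity, fun F x R ρ D hρ hR hD hF hdisj hB => ?_⟩
  have hsum : ∑ σ ∈ F, μ.real (interior (B.set σ)) ≤ μ.real (Metric.closedBall x (R + D)) := by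
    rw [← measureReal_biUnion_finset ?_ ?_ ?_]
    · refine measureReal_mono (iUnion₂_subset fun σ hσ y hy => ?_) measure_closedBall_lt_top.ne
      obtain ⟨k, hk⟩ := hF σ hσ
      obtain ⟨-, hσD, z, hz, hzR⟩ := hB σ hσ
      have h1 : dist y z ≤ B.size σ :=
        Metric.dist_le_diam_of_mem (B.isCompact_set hJ hk).isBounded (interior_subset hy) hz
      rw [Metric.mem_closedBall] at hzR ⊢
      linarith [dist_triangle y z x]
    · exact fun σ hσ τ hτ hne => hdisj σ hσ τ hτ hne
    · exact fun σ _ => isOpen_interior.measurableSet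
    · intro σ hσ
      obtain ⟨k, hk⟩ := hF σ hσ
      exact ((measure_mono interior_subset).trans_lt (B.isCompact_set hJ hk).measure_lt_top).ne
  have hball : μ.real (Metric.closedBall x (R + D)) =
      (R + D) ^ d * μ.real (Metric.ball (0 : EuclideanSpace ℝ (Fin d)) 1) := by
    rw [measureReal_def, Measure.addHaar_closedBall μ x (by positivity), ENNReal.toReal_mul,
      ENNReal.toReal_ofReal (by positivity), finrank_euclideanSpace_fin, measureReal_def]
  have hlow : F.card * ((ρ / Metric.diam J) ^ d * μ.real (interior J)) ≤
      ∑ σ ∈ F, μ.real (interior (B.set σ)) := by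
    rw [← nsmul_eq_mul]
    refine Finset.card_nsmul_le_sum _ _ _ fun σ hσ => ?_
    obtain ⟨k, hk⟩ := hF σ hσ
    rw [B.measureReal_interior hμ hJ0 hk]
    have := (hB σ hσ).1
    gcongr
  have h := (hlow.trans hsum).trans hball.le
  rw [← le_div_iff₀ (by positivity)] at h
  refine h.trans_eq ?_
  rw [div_pow, div_pow]
  field_simp

end BasicSets

end MoranData

theorem exists_isCover_encard_eq_externalCoveringNumber {X : Type*} [PseudoEMetricSpace X]
    (ε : ℝ≥0) (A : Set X) :
    ∃ C : Set X, Metric.IsCover ε A C ∧ C.encard = Metric.externalCoveringNumber ε A := by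
  have : Nonempty {C : Set X // Metric.IsCover ε A C} := ⟨⟨A, Metric.IsCover.refl ε A⟩⟩
  obtain ⟨C, hC⟩ := ENat.exists_eq_iInf
    fun C : {C : Set X // Metric.IsCover ε A C} => C.1.encard
  refine ⟨C.1, C.2, hC.trans ?_⟩
  rw [Metric.externalCoveringNumber, iInf_subtype]

namespace MoranData

namespace BasicSets

/-! ### The lower bound for the quasi-Assouad dimension -/

variable {M : MoranData} {d : ℕ} {J : Set (EuclideanSpace ℝ (Fin d))} (B : M.BasicSets J)

/-- If any ball of radius `r` meets at most `b` of the sets `I_τ`, `τ ∈ F`, where the `τ` are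
descendants of `σ`, then `F` has at most `b` times as many members as there are balls of radius `r`
in a cover of a ball of radius `|I_σ|`, since each `I_τ` contains a point of the limit set. -/
theorem card_le_of_coverNum_le (hJ : IsCompact J) (hJint : (interior J).Nonempty) {k : ℕ}
    {σ : List ℕ} (hσ : σ ∈ M.words k) {F : Finset (List ℕ)}
    (hF : ∀ τ ∈ F, ∃ n, τ ∈ M.descendants σ n) {r R v : ℝ≥0} (hR : (R : ℝ) = B.size σ)
    (hv : (coverNum B.limitSet r R : ℝ≥0∞) ≤ v) {b : ℝ}
    (hb : ∀ z : EuclideanSpace ℝ (Fin d), ∀ G ⊆ F,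
      (∀ τ ∈ G, (B.set τ ∩ Metric.closedBall z r).Nonempty) → (G.card : ℝ) ≤ b) :
    (F.card : ℝ) ≤ b * v := by
  classical
  have hJne : J.Nonempty := hJint.mono interior_subset
  obtain ⟨x, hxσ, hxE⟩ := B.inter_limitSet_nonempty hJ hJne hσ
  let x' : B.limitSet := ⟨x, hxE⟩
  obtain ⟨C, hC, hCcard⟩ := exists_isCover_encard_eq_externalCoveringNumber r
    (Metric.closedBall x' (R : ℝ))
  have hCv : ((C.encard : ℕ∞) : ℝ≥0∞) ≤ v := by
    refine le_trans ?_ hv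
    rw [hCcard]
    exact_mod_cast le_iSup (fun y : B.limitSet =>
      Metric.externalCoveringNumber r (Metric.closedBall y (R : ℝ))) x'
  have hCfin : C.Finite := by
    rw [← Set.encard_lt_top_iff, lt_top_iff_ne_top]
    rintro h
    rw [h] at hCv
    simp at hCv
  have hcard : (hCfin.toFinset.card : ℝ) ≤ v := by
    rw [hCfin.encard_eq_coe_toFinset_card] at hCv
    have : ((hCfin.toFinset.card : ℝ≥0) : ℝ≥0∞) ≤ v := by simpa using hCv
    exact_mod_cast ENNReal.coe_le_coe.mp this
  have hsub : F ⊆ hCfin.toFinset.biUnion fun z => F.filter fun τ =>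
      (B.set τ ∩ Metric.closedBall (z : EuclideanSpace ℝ (Fin d)) r).Nonempty := by
    intro τ hτ
    obtain ⟨n, hn⟩ := hF τ hτ
    have hw := ((mem_descendants hσ).mp hn).1
    obtain ⟨y, hyτ, hyE⟩ := B.inter_limitSet_nonempty hJ hJne hw
    have hyx : (⟨y, hyE⟩ : B.limitSet) ∈ Metric.closedBall x' (R : ℝ) := by
      rw [Metric.mem_closedBall, hR]
      exact Metric.dist_le_diam_of_mem (B.isCompact_set hJ hσ).isBounded
        (B.set_subset_of_mem_descendants hσ hn hyτ) hxσ
    obtain ⟨z, hz, hyz⟩ := hC hyx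
    refine Finset.mem_biUnion.mpr ⟨z, hCfin.mem_toFinset.mpr hz, Finset.mem_filter.mpr
      ⟨hτ, y, hyτ, ?_⟩⟩
    rw [Metric.mem_closedBall]
    have h : edist (⟨y, hyE⟩ : B.limitSet) z ≤ r := hyz
    rw [edist_nndist, ENNReal.coe_le_coe] at h
    exact_mod_cast h
  have hb0 : 0 ≤ b := by simpa using hb x ∅ (by simp) (by simp)
  calc (F.card : ℝ) ≤ ∑ z ∈ hCfin.toFinset, ((F.filter fun τ =>
        (B.set τ ∩ Metric.closedBall (z : EuclideanSpace ℝ (Fin d)) r).Nonempty).card : ℝ) := by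
        exact_mod_cast (Finset.card_le_card hsub).trans Finset.card_biUnion_le
    _ ≤ ∑ _z ∈ hCfin.toFinset, b := Finset.sum_le_sum fun z _ =>
        hb z _ (Finset.filter_subset _ _) fun τ hτ => (Finset.mem_filter.mp hτ).2
    _ = b * hCfin.toFinset.card := by rw [Finset.sum_const, nsmul_eq_mul, mul_comm]
    _ ≤ b * v := by gcongr

/-- If at every scale `c₁ ^ m |I_σ|` there are at most `C c₁ ^ (-m α)` descendants of `σ` of the
given generation, then summing their `t`-th moments over the scales gives a geometric bound for
`Δ` at every `t > α`. -/
theorem delta_le_of_card_scale_le (hJ0 : 0 < Metric.diam J) {c₀ c₁ : ℝ}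
    (hc : M.RatioBounds c₀ c₁) {k n : ℕ} {σ : List ℕ} (hσ : σ ∈ M.words k) {α t C : ℝ}
    (hα : 0 ≤ α) (hαt : α < t)
    (hC : ∀ m, n ≤ m → (((M.descendants σ n).filter fun τ => c₁ ^ (m + 1) * B.size σ < B.size τ ∧
      B.size τ ≤ c₁ ^ m * B.size σ).card : ℝ) ≤ C * ((c₁ ^ m)⁻¹) ^ α) :
    M.delta (k + 1) (k + n) t ≤ C * ((c₁ ^ (t - α)) ^ n / (1 - c₁ ^ (t - α))) := by
  classical
  have hc1 : 0 < c₁ := hc.pos.trans_le hc.le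
  have hD := B.size_pos hJ0 hσ
  have hmem : ∀ τ ∈ M.descendants σ n, ∃ m, n ≤ m ∧ c₁ ^ (m + 1) * B.size σ < B.size τ ∧
      B.size τ ≤ c₁ ^ m * B.size σ := by
    intro τ hτ
    have hτ0 := B.size_pos hJ0 ((mem_descendants hσ).mp hτ).1
    have hle : B.size τ / B.size σ ≤ c₁ ^ n := by
      rw [div_le_iff₀ hD]
      exact (B.size_descendants hJ0 hc hσ hτ).2
    obtain ⟨m, h1, h2⟩ := exists_nat_pow_near_of_lt_one (div_pos hτ0 hD)
      (hle.trans (pow_le_one₀ hc1.le hc.lt_one.le)) hc1 hc.lt_one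
    refine ⟨m, ?_, (lt_div_iff₀ hD).mp h1, (div_le_iff₀ hD).mp h2⟩
    exact Nat.lt_succ_iff.mp ((pow_lt_pow_iff_right_of_lt_one₀ hc1 hc.lt_one).mp
      (h1.trans_le hle))
  choose! g hgn hg1 hg2 using hmem
  have hsum := B.sum_size_rpow hJ0 hσ (n := n) t
  have hDt : 0 < B.size σ ^ t := Real.rpow_pos_of_pos hD t
  set β := c₁ ^ (t - α) with hβ
  have hβ0 : 0 ≤ β := Real.rpow_nonneg hc1.le _
  have hβ1 : β < 1 := Real.rpow_lt_one hc1.le hc.lt_one (by linarith)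
  have hC0 : 0 ≤ C := by
    have h := (Nat.cast_nonneg _).trans (hC n le_rfl)
    exact nonneg_of_mul_nonneg_left h (Real.rpow_pos_of_pos (by positivity) _)
  have hfib : ∀ m, n ≤ m → ∑ τ ∈ (M.descendants σ n).filter (fun τ => g τ = m), B.size τ ^ t ≤
      C * β ^ m * B.size σ ^ t := by
    intro m hm
    have hcm : 0 < c₁ ^ m := by positivity
    have hcard : (((M.descendants σ n).filter fun τ => g τ = m).card : ℝ) ≤
        C * ((c₁ ^ m)⁻¹) ^ α := by
      refine le_trans ?_ (hC m hm)
      exact_mod_cast Finset.card_le_card fun τ hτ => by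
        rw [Finset.mem_filter] at hτ ⊢
        obtain ⟨h, rfl⟩ := hτ
        exact ⟨h, hg1 τ h, hg2 τ h⟩
    calc _ ≤ ∑ τ ∈ (M.descendants σ n).filter (fun τ => g τ = m), (c₁ ^ m * B.size σ) ^ t := by
          refine Finset.sum_le_sum fun τ hτ => ?_
          rw [Finset.mem_filter] at hτ
          obtain ⟨h, rfl⟩ := hτ
          exact Real.rpow_le_rpow (B.size_nonneg τ) (hg2 τ h) (by linarith)
      _ = (((M.descendants σ n).filter fun τ => g τ = m).card : ℝ) *
          ((c₁ ^ m) ^ t * B.size σ ^ t) := by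
          rw [Finset.sum_const, nsmul_eq_mul, Real.mul_rpow hcm.le hD.le]
      _ ≤ (C * ((c₁ ^ m)⁻¹) ^ α) * ((c₁ ^ m) ^ t * B.size σ ^ t) := by gcongr
      _ = C * β ^ m * B.size σ ^ t := by
          have : β ^ m = ((c₁ ^ m)⁻¹) ^ α * (c₁ ^ m) ^ t := by
            rw [hβ, ← Real.rpow_natCast, ← Real.rpow_mul hc1.le, mul_comm, Real.rpow_mul hc1.le,
              Real.rpow_natCast, Real.rpow_sub hcm, Real.inv_rpow hcm.le]
            ring
          rw [this]
          ring
  obtain ⟨N, hN⟩ : ∃ N, ∀ τ ∈ M.descendants σ n, g τ < N :=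
    ⟨(M.descendants σ n).sup g + 1, fun τ hτ => Nat.lt_succ_of_le (Finset.le_sup hτ)⟩
  have hmaps : ∀ τ ∈ M.descendants σ n, g τ ∈ Finset.Ico n N := fun τ hτ =>
    Finset.mem_Ico.mpr ⟨hgn τ hτ, hN τ hτ⟩
  have htot : B.size σ ^ t * M.delta (k + 1) (k + n) t ≤
      B.size σ ^ t * (C * (β ^ n / (1 - β))) := by
    rw [← hsum, ← Finset.sum_fiberwise_of_maps_to hmaps]
    calc _ ≤ ∑ m ∈ Finset.Ico n N, C * β ^ m * B.size σ ^ t :=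
          Finset.sum_le_sum fun m hm => hfib m (Finset.mem_Ico.mp hm).1
      _ = B.size σ ^ t * (C * ∑ m ∈ Finset.Ico n N, β ^ m) := by
          rw [Finset.mul_sum, Finset.mul_sum]
          exact Finset.sum_congr rfl fun m _ => by ring
      _ ≤ _ := by
          gcongr
          exact geom_sum_Ico_le_of_lt_one hβ0 hβ1
  exact le_of_mul_le_mul_left htot hDt

/-- The choice `δ = η log c₁ / (4 log c₀)` makes `r = c₁ ^ m R` satisfy `r ^ (1 - δ) ≤ R` when `R`
is the diameter of a basic set of level about `p` and at least `η q - K` further levels lie between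
`R` and `r`. -/
theorem rpow_scale_le {c₀ c₁ η ℓ K q p m R : ℝ} (h0 : 0 < c₀) (h01 : c₀ ≤ c₁) (h1 : c₁ < 1)
    (hη : 0 < η) (hη1 : η < 1) (hℓ : 0 < ℓ) (hK : 0 ≤ K) (hp : p ≤ q * (1 - η))
    (hm : q - p - K ≤ m) (hm0 : 0 ≤ m) (hR : 0 < R)
    (hRlow : ℓ * c₀ ^ (p + K) ≤ R)
    (hq : 2 * K + 2 * (|Real.log ℓ| / -Real.log c₁) ≤ η * q) :
    (c₁ ^ m * R) ^ (1 - η * Real.log c₁ / (4 * Real.log c₀)) ≤ R := by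
  have hc1 : 0 < c₁ := h0.trans_le h01
  obtain ⟨l1, hl1⟩ : ∃ l, l = -Real.log c₁ := ⟨_, rfl⟩
  obtain ⟨l0, hl0⟩ : ∃ l, l = -Real.log c₀ := ⟨_, rfl⟩
  have hl1p : 0 < l1 := by rw [hl1]; linarith [Real.log_neg hc1 h1]
  have hl10 : l1 ≤ l0 := by rw [hl1, hl0]; linarith [Real.log_le_log h0 h01]
  have hl0p : 0 < l0 := by linarith
  obtain ⟨δ, hδ⟩ : ∃ δ, δ = η * Real.log c₁ / (4 * Real.log c₀) := ⟨_, rfl⟩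
  have hδl : δ * l0 = η * l1 / 4 := by
    rw [hδ, hl0, hl1]
    have : Real.log c₀ ≠ 0 := by intro h; rw [h] at hl0; linarith
    field_simp
  have hδ' : δ = η * l1 / 4 / l0 := eq_div_of_mul_eq hl0p.ne' hδl
  have hδ0 : 0 ≤ δ := by rw [hδ']; positivity
  have hδ1 : δ ≤ 1 / 4 := by
    rw [hδ', div_le_iff₀ hl0p]
    linarith [mul_le_mul_of_nonneg_right hη1.le hl1p.le]
  rw [← hδ]
  have hr : 0 < c₁ ^ m * R := mul_pos (Real.rpow_pos_of_pos hc1 _) hR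
  rw [← Real.log_le_log_iff (Real.rpow_pos_of_pos hr _) hR, Real.log_rpow hr,
    Real.log_mul (Real.rpow_pos_of_pos hc1 _).ne' hR.ne', Real.log_rpow hc1]
  have hlogR : Real.log ℓ - (p + K) * l0 ≤ Real.log R := by
    have := Real.log_le_log (mul_pos hℓ (Real.rpow_pos_of_pos h0 _)) hRlow
    rw [Real.log_mul hℓ.ne' (Real.rpow_pos_of_pos h0 _).ne', Real.log_rpow h0] at this
    rw [hl0]
    linarith
  rw [← hl1, ← sub_nonneg] at hq
  have hq' : 0 ≤ η * q * l1 - 2 * K * l1 - 2 * |Real.log ℓ| := by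
    have := mul_nonneg hq hl1p.le
    have he : |Real.log ℓ| / l1 * l1 = |Real.log ℓ| := div_mul_cancel₀ _ hl1p.ne'
    linarith
  have hlog1 : Real.log c₁ = -l1 := by linarith
  rw [hlog1]
  have e1 : δ * (Real.log ℓ - (p + K) * l0) ≤ δ * Real.log R := mul_le_mul_of_nonneg_left hlogR hδ0
  have e2 : δ * ((p + K) * l0) = η * l1 / 4 * (p + K) := by rw [← hδl]; ring
  have e3 : -|Real.log ℓ| ≤ δ * Real.log ℓ := by
    have h := neg_abs_le (δ * Real.log ℓ)
    rw [abs_mul, abs_of_nonneg hδ0] at h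
    linarith [mul_le_of_le_one_left (abs_nonneg (Real.log ℓ)) (show δ ≤ 1 by linarith)]
  have hmq : η * q - K ≤ m := by linarith
  have e4 : 3 / 4 * (η * q - K) * l1 ≤ (1 - δ) * (m * l1) := by
    have : 3 / 4 * (m * l1) ≤ (1 - δ) * (m * l1) :=
      mul_le_mul_of_nonneg_right (by linarith) (mul_nonneg hm0 hl1p.le)
    linarith [mul_le_mul_of_nonneg_right hmq hl1p.le]
  have hKl : 0 ≤ K * l1 := mul_nonneg hK hl1p.le
  have e5 : η * l1 / 4 * (p + K) ≤ η * q * l1 / 4 + K * l1 / 4 := by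
    have hηl := mul_pos hη hl1p
    have hq0 : 0 ≤ η * q := by
      have := abs_nonneg (Real.log ℓ)
      have : 0 ≤ |Real.log ℓ| / l1 := by positivity
      linarith
    have hq0' : 0 ≤ q := nonneg_of_mul_nonneg_right hq0 hη
    have hpq : p ≤ q := by linarith
    linarith [mul_le_mul_of_nonneg_left hpq hηl.le, mul_le_mul_of_nonneg_right hη1.le hKl]
  linarith

/-- An exponent `α < t` admissible for `h(δ)` would, by counting descendants with the covering
number scale by scale, make `Δ_{p,q}(t)` tend to `0` along all `p ≤ q (1 - η)`, whereas
`Δ_{p,q}(t) ≥ 1` for infinitely many `q` if `t` is below the `limsup`. -/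
theorem exists_limsup_le_hExponent (hJ : IsCompact J) (hJint : (interior J).Nonempty)
    (hJ0 : 0 < Metric.diam J) {c₀ c₁ : ℝ} (hc : M.RatioBounds c₀ c₁) {η : ℝ} (hη : 0 < η)
    (hη1 : η < 1) : ∃ δ ∈ Ioo (0 : ℝ) 1,
      limsup (fun q : ℕ => M.maxExponent η q) atTop ≤ hExponent B.limitSet δ := by
  have hc0 := hc.pos
  have hc1 : 0 < c₁ := hc.pos.trans_le hc.le
  have hl1 := Real.log_neg hc1 hc.lt_one
  have hl10 := Real.log_le_log hc.pos hc.le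
  have hl0 : Real.log c₀ < 0 := by linarith
  refine ⟨η * Real.log c₁ / (4 * Real.log c₀), ⟨div_pos_of_neg_of_neg (mul_neg_of_pos_of_neg hη hl1)
    (by linarith), ?_⟩, ?_⟩
  · rw [div_lt_one_of_neg (by linarith)]
    nlinarith
  obtain ⟨δ, hδ⟩ : ∃ δ, δ = η * Real.log c₁ / (4 * Real.log c₀) := ⟨_, rfl⟩
  have hδ0 : 0 < δ := by
    rw [hδ]; exact div_pos_of_neg_of_neg (mul_neg_of_pos_of_neg hη hl1) (by linarith)
  rw [← hδ]
  refine le_iInf₂ fun α hα => ?_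
  obtain ⟨b, c, hb, hcpos, hbc⟩ := hα
  by_contra! hcon
  obtain ⟨t, hαt, htL⟩ := ENNReal.lt_iff_exists_nnreal_btwn.mp hcon
  have hαt' : (α : ℝ) < t := by exact_mod_cast hαt
  obtain ⟨κ, hκ, hpack⟩ := B.exists_packing_bound hJ hJint hJ0
  obtain ⟨A, hA, hAsum⟩ := B.exists_sum_ratio_rpow_le hJ hJint hJ0 hc
  -- Shifting the first level by `K` makes the basic sets smaller than the admissible radii.
  obtain ⟨K, hK⟩ : ∃ K : ℕ, c₁ ^ K * Metric.diam J < min (b : ℝ) 1 := by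
    obtain ⟨K, hK⟩ := exists_pow_lt_of_lt_one (y := c₁)
      (div_pos (lt_min (NNReal.coe_pos.mpr hb) one_pos) hJ0) hc.lt_one
    exact ⟨K, (lt_div_iff₀ hJ0).mp hK⟩
  set β := c₁ ^ ((t : ℝ) - α) with hβ
  have hβ0 : 0 ≤ β := Real.rpow_nonneg hc1.le _
  have hβ1 : β < 1 := Real.rpow_lt_one hc1.le hc.lt_one (by linarith)
  set C := κ * (2 / c₁) ^ d * c with hC
  obtain ⟨N, hN⟩ : ∃ N : ℕ, ∀ n ≥ N, C * (β ^ n / (1 - β)) < (A ^ K)⁻¹ := by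
    have h : Tendsto (fun n : ℕ => C * (β ^ n / (1 - β))) atTop (𝓝 (C * (0 / (1 - β)))) :=
      ((tendsto_pow_atTop_nhds_zero_of_lt_one hβ0 hβ1).div_const _).const_mul _
    rw [zero_div, mul_zero] at h
    exact eventually_atTop.mp (h.eventually (gt_mem_nhds (by positivity)))
  have hlarge : ∀ᶠ q : ℕ in atTop,
      K + N + (2 * K + 2 * (|Real.log (Metric.diam J)| / -Real.log c₁)) ≤ η * q :=
    (tendsto_natCast_atTop_atTop.const_mul_atTop hη).eventually_ge_atTop _
  obtain ⟨q, hqt, hqN⟩ := ((frequently_lt_of_lt_limsup (by isBoundedDefault) htL).and_eventually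
    hlarge).exists
  obtain ⟨p, hp⟩ := lt_iSup_iff.mp hqt
  obtain ⟨⟨hp1, hpq⟩, hpt⟩ := lt_iSup_iff.mp hp
  have hexp : (t : ℝ) < M.exponent p q := by
    rw [← ENNReal.ofReal_coe_nnreal] at hpt
    exact (ENNReal.ofReal_lt_ofReal_iff'.mp hpt).1
  obtain ⟨p, rfl⟩ : ∃ l, p = l + 1 := ⟨p - 1, by omega⟩
  have habs : 0 ≤ |Real.log (Metric.diam J)| / -Real.log c₁ := by
    have := abs_nonneg (Real.log (Metric.diam J))
    exact div_nonneg this (by linarith)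
  have hKN : p + 1 + K + N ≤ q := by
    have : ((p + 1 : ℕ) : ℝ) + K + N ≤ q := by linarith [(Nat.cast_nonneg K : (0 : ℝ) ≤ K)]
    exact_mod_cast this
  obtain ⟨n, rfl⟩ : ∃ n, q = p + K + n := ⟨q - (p + K), by omega⟩
  have hnN : N ≤ n := by omega
  have hΔ := one_le_delta (M := M) hp1 (by omega) hexp.le
  rw [delta_split (m := p + K) (by omega) (by omega)] at hΔ
  have hΔK := delta_le_pow (M := M) (s := t) (fun i hi => hAsum t t.2 i hi) p K
  have hΔlow : (A ^ K)⁻¹ ≤ M.delta (p + K + 1) (p + K + n) t := by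
    rw [inv_le_iff_one_le_mul₀' (by positivity)]
    exact hΔ.trans (mul_le_mul_of_nonneg_right hΔK (delta_pos (by omega) _).le)
  obtain ⟨σ, hσ⟩ := words_nonempty (M := M) (p + K)
  have hD := B.size_pos hJ0 hσ
  obtain ⟨hDlow, hDup⟩ := B.size_words hJ0 hc hσ
  have hDmin : B.size σ < min (b : ℝ) 1 := by
    refine (hDup.trans ?_).trans_lt hK
    exact mul_le_mul_of_nonneg_right
      (pow_le_pow_of_le_one hc1.le hc.lt_one.le (by omega)) hJ0.le
  -- The ball of radius `R = |I_σ|` is compared with the scales `r = c₁ ^ m R`.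
  refine (hN n hnN).not_ge (hΔlow.trans (B.delta_le_of_card_scale_le hJ0 hc hσ α.2 hαt' ?_))
  intro m hm
  obtain ⟨R, hR⟩ : ∃ R : ℝ≥0, (R : ℝ) = B.size σ := ⟨⟨_, hD.le⟩, rfl⟩
  obtain ⟨γ, hγ⟩ : ∃ γ : ℝ≥0, (γ : ℝ) = c₁ ^ m := ⟨⟨_, by positivity⟩, rfl⟩
  have hγ0 : 0 < γ := by rw [← NNReal.coe_pos, hγ]; positivity
  have hR0 : 0 < R := by rw [← NNReal.coe_pos, hR]; exact hD
  have hγ1 : γ ≤ 1 := by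
    rw [← NNReal.coe_le_coe, hγ]; exact pow_le_one₀ hc1.le hc.lt_one.le
  have hr0 : 0 < γ * R := mul_pos hγ0 hR0
  have hr1 : γ * R < 1 := by
    refine (mul_le_of_le_one_left' hγ1).trans_lt ?_
    rw [← NNReal.coe_lt_coe, hR]
    exact hDmin.trans_le (min_le_right _ _)
  have hcov := hbc (γ * R) R hr0 ?_ ?_ ?_
  · have hb' := B.card_le_of_coverNum_le hJ hJint hσ
      (F := (M.descendants σ n).filter fun τ => c₁ ^ (m + 1) * B.size σ < B.size τ ∧
        B.size τ ≤ c₁ ^ m * B.size σ) (fun τ hτ => ⟨n, (Finset.mem_filter.mp hτ).1⟩) hR hcov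
      (b := κ * (2 / c₁) ^ d) ?_
    · refine hb'.trans_eq ?_
      rw [NNReal.coe_mul, NNReal.coe_rpow, NNReal.coe_div, NNReal.coe_mul, hγ, hR,
        div_mul_cancel_right₀ hD.ne', hC]
      ring
    · intro z G hG hGz
      have hG' : ∀ τ ∈ G, τ ∈ M.words (p + K + n) ∧ c₁ ^ (m + 1) * B.size σ < B.size τ ∧
          B.size τ ≤ c₁ ^ m * B.size σ := fun τ hτ =>
        have h := Finset.mem_filter.mp (hG hτ)
        ⟨((mem_descendants hσ).mp h.1).1, h.2⟩
      have hr : ((γ * R : ℝ≥0) : ℝ) = c₁ ^ m * B.size σ := by rw [NNReal.coe_mul, hγ, hR]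
      have h := hpack G z (γ * R : ℝ≥0) (c₁ ^ (m + 1) * B.size σ) (c₁ ^ m * B.size σ)
        (by positivity) (NNReal.coe_nonneg _) (by positivity) (fun τ hτ => ⟨_, (hG' τ hτ).1⟩)
        (fun τ hτ τ' hτ' hne => B.disjoint_interior_of_length_eq (hG' τ hτ).1 (hG' τ' hτ').1 hne)
        (fun τ hτ => ⟨(hG' τ hτ).2.1.le, (hG' τ hτ).2.2, hGz τ hτ⟩)
      refine h.trans_eq ?_
      rw [hr, pow_succ]
      congr 2
      field_simp
      norm_num
  · calc γ * R = (γ * R) ^ (1 : ℝ) := (NNReal.rpow_one _).symm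
      _ < (γ * R) ^ (1 - δ) := NNReal.rpow_lt_rpow_of_exponent_gt hr0 hr1 (by linarith)
  · rw [← NNReal.coe_le_coe, NNReal.coe_rpow, NNReal.coe_mul, hγ, hR, hδ,
      ← Real.rpow_natCast c₁ m]
    push_cast at hpq hqN
    refine rpow_scale_le (ℓ := Metric.diam J) (K := K) (p := p) (q := p + K + n) hc0 hc.le
      hc.lt_one hη hη1 hJ0 (Nat.cast_nonneg _) (by linarith) ?_ (Nat.cast_nonneg _) hD ?_ ?_
    · have : (n : ℝ) ≤ m := by exact_mod_cast hm
      linarith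
    · rw [mul_comm]
      exact_mod_cast hDlow
    · linarith [(Nat.cast_nonneg K : (0 : ℝ) ≤ K), (Nat.cast_nonneg N : (0 : ℝ) ≤ N)]
  · rw [← NNReal.coe_lt_coe, hR]
    exact hDmin.trans_le (min_le_left _ _)

/-! ### The upper bound for the quasi-Assouad dimension -/

/-- The word `τ` of length `k + 1` is the first of its prefixes whose basic set has diameter at
most `ρ`. -/
structure IsCut (ρ : ℝ) (k : ℕ) (τ : List ℕ) : Prop where
  mem : τ ∈ M.words (k + 1)
  size_le : B.size τ ≤ ρ
  lt_size : ρ < B.size (τ.take k)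

variable {B}

theorem IsCut.mul_le_size {c₀ c₁ : ℝ} (hc : M.RatioBounds c₀ c₁) (hJ0 : 0 < Metric.diam J)
    {ρ : ℝ} {k : ℕ} {τ : List ℕ} (h : B.IsCut ρ k τ) : c₀ * ρ ≤ B.size τ := by
  obtain ⟨σ, hσ, j, h1, h2, rfl⟩ := exists_append_of_mem_words_succ h.mem
  have hlt := h.lt_size
  rw [← hσ.1, List.take_left] at hlt
  rw [B.size_append hJ0 hσ h1 h2, mul_comm]
  have hlow := hc.lower (k + 1) j (by omega) h1 h2
  have h0 := hc.pos
  have := B.size_nonneg σ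
  calc ρ * c₀ ≤ B.size σ * c₀ := by gcongr
    _ ≤ _ := by gcongr

theorem IsCut.disjoint_interior (hJ : IsCompact J) {ρ : ℝ} {k l : ℕ} {σ τ : List ℕ}
    (hσ : B.IsCut ρ k σ) (hτ : B.IsCut ρ l τ) (hne : σ ≠ τ) :
    Disjoint (interior (B.set σ)) (interior (B.set τ)) := by
  wlog hkl : k ≤ l generalizing k l σ τ
  · exact (this hτ hσ hne.symm (by omega)).symm
  have hmem := take_mem_words hτ.mem (Nat.succ_le_succ hkl)
  refine (B.disjoint_interior_of_length_eq hσ.mem hmem ?_).mono_right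
    (interior_mono (B.set_subset_take hτ.mem (Nat.succ_le_succ hkl)))
  rintro rfl
  rcases hkl.lt_or_eq with h | rfl
  · have h1 := B.size_le_size_take hJ (take_mem_words hτ.mem (Nat.le_succ l))
      (show k + 1 ≤ l from h)
    rw [List.take_take, min_eq_left (by omega)] at h1
    exact (hτ.lt_size.trans_le h1).not_ge hσ.size_le
  · exact hne (List.take_of_length_le hτ.mem.1.le)

theorem exists_isCut_take {ρ : ℝ} (hρ : ρ < Metric.diam J) {K : ℕ} {τ : List ℕ}
    (hτ : τ ∈ M.words K) (hsize : B.size τ ≤ ρ) :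
    ∃ i, i < K ∧ B.IsCut ρ i (τ.take (i + 1)) := by
  classical
  have hex : ∃ i, B.size (τ.take i) ≤ ρ := ⟨K, by rwa [List.take_of_length_le hτ.1.le]⟩
  have hspec := Nat.find_spec hex
  have hK : Nat.find hex ≤ K := Nat.find_min' hex (by rwa [List.take_of_length_le hτ.1.le])
  have hne : Nat.find hex ≠ 0 := by
    intro h0
    rw [h0, List.take_zero, size, B.root] at hspec
    exact hspec.not_gt hρ
  obtain ⟨i, hi⟩ := Nat.exists_eq_succ_of_ne_zero hne
  rw [hi] at hspec
  refine ⟨i, by omega, take_mem_words hτ (by omega), hspec, ?_⟩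
  rw [List.take_take, min_eq_left (Nat.le_succ i)]
  exact not_le.mp (Nat.find_min hex (by omega))

/-- Descendants of `σ` of size at least `c₀ r`, possibly of many different generations, are
counted by their moments of order `s + ε`; the extra `ε` makes the sum over the generations
converge geometrically. -/
theorem card_le_of_delta_le_one (hJ0 : 0 < Metric.diam J) {c₀ c₁ : ℝ} (hc : M.RatioBounds c₀ c₁)
    {k : ℕ} {σ : List ℕ} (hσ : σ ∈ M.words k) {T : Finset (List ℕ)} {r R s ε : ℝ} (hr : 0 < r)
    (hR : B.size σ ≤ R) (hs : 0 ≤ s) (hε : 0 < ε)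
    (hT : ∀ τ ∈ T, ∃ n, τ ∈ M.descendants σ n ∧ c₀ * r ≤ B.size τ ∧
      M.delta (k + 1) (k + n) s ≤ 1) :
    (T.card : ℝ) ≤ (1 - c₁ ^ ε)⁻¹ * (c₀ ^ (s + ε))⁻¹ * (R / r) ^ (s + ε) := by
  classical
  have hc0 := hc.pos
  have hc1 : 0 < c₁ := hc.pos.trans_le hc.le
  have hD := B.size_pos hJ0 hσ
  have hR0 : 0 < R := hD.trans_le hR
  choose! g hg hgr hgΔ using hT
  set β := c₁ ^ ε with hβ
  have hβ0 : 0 ≤ β := Real.rpow_nonneg hc1.le _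
  have hβ1 : β < 1 := Real.rpow_lt_one hc1.le hc.lt_one hε
  have hfib : ∀ n, ∑ τ ∈ T.filter (fun τ => g τ = n), B.size τ ^ (s + ε) ≤
      B.size σ ^ (s + ε) * β ^ n := by
    intro n
    rcases (T.filter fun τ => g τ = n).eq_empty_or_nonempty with he | ⟨τ₀, hτ₀⟩
    · rw [he, Finset.sum_empty]
      positivity
    have hΔ : M.delta (k + 1) (k + n) s ≤ 1 := by
      rw [Finset.mem_filter] at hτ₀
      obtain ⟨h, rfl⟩ := hτ₀
      exact hgΔ τ₀ h
    have hsub : T.filter (fun τ => g τ = n) ⊆ M.descendants σ n := by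
      intro τ hτ
      rw [Finset.mem_filter] at hτ
      obtain ⟨h, rfl⟩ := hτ
      exact hg τ h
    calc _ ≤ ∑ τ ∈ M.descendants σ n, B.size τ ^ (s + ε) :=
          Finset.sum_le_sum_of_subset_of_nonneg hsub fun τ _ _ =>
            Real.rpow_nonneg (B.size_nonneg τ) _
      _ ≤ ∑ τ ∈ M.descendants σ n, B.size τ ^ s * (c₁ ^ n * B.size σ) ^ ε := by
          refine Finset.sum_le_sum fun τ hτ => ?_
          rw [Real.rpow_add (B.size_pos hJ0 ((mem_descendants hσ).mp hτ).1)]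
          exact mul_le_mul_of_nonneg_left (Real.rpow_le_rpow (B.size_nonneg τ)
            (B.size_descendants hJ0 hc hσ hτ).2 hε.le) (Real.rpow_nonneg (B.size_nonneg τ) _)
      _ = B.size σ ^ s * M.delta (k + 1) (k + n) s * (c₁ ^ n * B.size σ) ^ ε := by
          rw [← Finset.sum_mul, B.sum_size_rpow hJ0 hσ]
      _ ≤ B.size σ ^ s * 1 * (c₁ ^ n * B.size σ) ^ ε := by gcongr
      _ = B.size σ ^ (s + ε) * β ^ n := by
          rw [Real.rpow_add hD, Real.mul_rpow (by positivity) hD.le, hβ, ← Real.rpow_natCast,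
            ← Real.rpow_natCast, ← Real.rpow_mul hc1.le, ← Real.rpow_mul hc1.le,
            mul_comm (n : ℝ) ε]
          ring
  have hmaps : ∀ τ ∈ T, g τ ∈ Finset.Ico 0 (T.sup g + 1) := fun τ hτ =>
    Finset.mem_Ico.mpr ⟨Nat.zero_le _, Nat.lt_succ_of_le (Finset.le_sup hτ)⟩
  have htot : ∑ τ ∈ T, B.size τ ^ (s + ε) ≤ R ^ (s + ε) * (1 - β)⁻¹ := by
    rw [← Finset.sum_fiberwise_of_maps_to hmaps]
    calc _ ≤ ∑ n ∈ Finset.Ico 0 (T.sup g + 1), B.size σ ^ (s + ε) * β ^ n :=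
          Finset.sum_le_sum fun n _ => hfib n
      _ = B.size σ ^ (s + ε) * ∑ n ∈ Finset.Ico 0 (T.sup g + 1), β ^ n :=
          (Finset.mul_sum _ _ _).symm
      _ ≤ R ^ (s + ε) * (1 - β)⁻¹ := by
          have h := geom_sum_Ico_le_of_lt_one (m := 0) (n := T.sup g + 1) hβ0 hβ1
          rw [pow_zero, one_div] at h
          gcongr
  have hlow : T.card * (c₀ * r) ^ (s + ε) ≤ ∑ τ ∈ T, B.size τ ^ (s + ε) := by
    rw [← nsmul_eq_mul]
    refine Finset.card_nsmul_le_sum _ _ _ fun τ hτ => ?_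
    exact Real.rpow_le_rpow (by positivity) (hgr τ hτ) (by positivity)
  have h := hlow.trans htot
  rw [← le_div_iff₀ (by positivity)] at h
  refine h.trans_eq ?_
  rw [Real.div_rpow hR0.le hr.le, Real.mul_rpow hc0.le hr.le]
  field_simp

/-- If `r ^ (1 - δ) ≤ R`, then between the diameters `R` and `r` a fixed proportion `η` of the
levels is passed. -/
theorem level_le_of_rpow_le (hJ0 : 0 < Metric.diam J) {c₀ c₁ : ℝ} (hc : M.RatioBounds c₀ c₁)
    {k n : ℕ} {σ τ : List ℕ} (hσ : σ ∈ M.words k) (hτ : τ ∈ M.descendants σ n) {r R δ : ℝ}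
    (hr : 0 < r) (hδ1 : δ < 1) (hδ0 : 0 < δ) (hrR : r ^ (1 - δ) ≤ R) (hσR : c₀ * R ≤ B.size σ)
    (hτr : c₀ * r ≤ B.size τ) (hτr' : B.size τ ≤ r)
    (hlarge : 3 + |Real.log (Metric.diam J)| / -Real.log c₀ ≤
      δ * Real.log c₁ / (2 * Real.log c₀) * ((k + n : ℕ) : ℝ)) :
    ((k + 1 : ℕ) : ℝ) ≤ ((k + n : ℕ) : ℝ) * (1 - δ * Real.log c₁ / (2 * Real.log c₀)) := by
  have hc0 := hc.pos
  have hc1 : 0 < c₁ := hc.pos.trans_le hc.le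
  obtain ⟨l1, hl1⟩ : ∃ l, l = -Real.log c₁ := ⟨_, rfl⟩
  obtain ⟨l0, hl0⟩ : ∃ l, l = -Real.log c₀ := ⟨_, rfl⟩
  have hl1p : 0 < l1 := by rw [hl1]; linarith [Real.log_neg hc1 hc.lt_one]
  have hl10 : l1 ≤ l0 := by rw [hl1, hl0]; linarith [Real.log_le_log hc0 hc.le]
  have hl0p : 0 < l0 := by linarith
  have hlog0 : Real.log c₀ = -l0 := by linarith
  have hlog1 : Real.log c₁ = -l1 := by linarith
  obtain ⟨η, hη⟩ : ∃ η, η = δ * Real.log c₁ / (2 * Real.log c₀) := ⟨_, rfl⟩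
  rw [← hη] at hlarge ⊢
  have hηl : η * l0 = δ * l1 / 2 := by
    rw [hη, hlog0, hlog1]
    field_simp
  have hrδ : 0 < r ^ (1 - δ) := Real.rpow_pos_of_pos hr _
  have h1 : c₀ ^ (n + 1) * r ^ (1 - δ) ≤ r := by
    calc c₀ ^ (n + 1) * r ^ (1 - δ) = c₀ ^ n * (c₀ * r ^ (1 - δ)) := by ring
      _ ≤ c₀ ^ n * B.size σ := by
          gcongr
          exact (mul_le_mul_of_nonneg_left hrR hc0.le).trans hσR
      _ ≤ r := (B.size_descendants hJ0 hc hσ hτ).1.trans hτr'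
  have h2 : c₀ * r ≤ c₁ ^ (k + n) * Metric.diam J :=
    hτr.trans (B.size_words hJ0 hc ((mem_descendants hσ).mp hτ).1).2
  have h1' := Real.log_le_log (by positivity) h1
  rw [Real.log_mul (by positivity) hrδ.ne', Real.log_pow, Real.log_rpow hr, hlog0] at h1'
  have h2' := Real.log_le_log (by positivity) h2
  rw [Real.log_mul hc0.ne' hr.ne', Real.log_mul (by positivity) hJ0.ne', Real.log_pow, hlog0,
    hlog1] at h2'
  rw [← hl0] at hlarge
  obtain ⟨q, hq⟩ : ∃ q : ℝ, q = ((k + n : ℕ) : ℝ) := ⟨_, rfl⟩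
  rw [← hq] at h2' hlarge ⊢
  have hlarge' : 3 * l0 + |Real.log (Metric.diam J)| ≤ η * l0 * q := by
    have := mul_le_mul_of_nonneg_right hlarge hl0p.le
    rw [add_mul, div_mul_cancel₀ _ hl0p.ne'] at this
    linarith
  have h3 : δ * (q * l1) ≤ δ * (l0 + Real.log (Metric.diam J) - Real.log r) :=
    mul_le_mul_of_nonneg_left (by linarith) hδ0.le
  have h4 : δ * (l0 + Real.log (Metric.diam J)) ≤ l0 + |Real.log (Metric.diam J)| := by
    have ha : δ * (l0 + Real.log (Metric.diam J)) ≤ δ * (l0 + |Real.log (Metric.diam J)|) :=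
      mul_le_mul_of_nonneg_left (by linarith [le_abs_self (Real.log (Metric.diam J))]) hδ0.le
    exact ha.trans (mul_le_of_le_one_left (by positivity) hδ1.le)
  have h5 : δ * (q * l1) = 2 * (η * l0 * q) := by rw [hηl]; ring
  have h6 : η * q + 1 ≤ n := by
    refine le_of_mul_le_mul_right ?_ hl0p
    push_cast at h1'
    linarith
  push_cast at hq ⊢
  linarith

variable (B)

/-- A ball of radius `R` meets at most `a` basic sets of diameter about `R`, and each of these
contains at most `b` basic sets of diameter about `r`, each of which lies in a ball of radius `r`
around any of its points. -/
theorem coverNum_le (hJ : IsCompact J) (hJint : (interior J).Nonempty)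
    (hJ0 : 0 < Metric.diam J) {c₀ c₁ : ℝ} (hc : M.RatioBounds c₀ c₁) {r R : ℝ≥0} (hr : 0 < r)
    (hrR : r ≤ R) (hRJ : (R : ℝ) < Metric.diam J) {a b : ℝ} (hb : 0 ≤ b)
    (hS : ∀ (S : Finset (List ℕ)) (x : EuclideanSpace ℝ (Fin d)), (∀ σ ∈ S, ∃ k, B.IsCut R k σ) →
      (∀ σ ∈ S, (B.set σ ∩ Metric.closedBall x R).Nonempty) → (S.card : ℝ) ≤ a)
    (hT : ∀ (k : ℕ) (σ : List ℕ) (T : Finset (List ℕ)), B.IsCut R k σ →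
      (∀ τ ∈ T, ∃ n, τ ∈ M.descendants σ n ∧ ∃ l, B.IsCut r l τ) → (T.card : ℝ) ≤ b)
    {v : ℝ≥0} (hv : a * b ≤ v) : (coverNum B.limitSet r R : ℝ≥0∞) ≤ v := by
  classical
  have hc1 : 0 < c₁ := hc.pos.trans_le hc.le
  have hJne : J.Nonempty := hJint.mono interior_subset
  suffices h : coverNum B.limitSet r R ≤ (⌊v⌋₊ : ℕ∞) by
    calc (coverNum B.limitSet r R : ℝ≥0∞) ≤ ((⌊v⌋₊ : ℕ∞) : ℝ≥0∞) := ENat.toENNReal_mono h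
      _ = ((⌊v⌋₊ : ℝ≥0) : ℝ≥0∞) := by simp
      _ ≤ v := ENNReal.coe_le_coe.mpr (Nat.floor_le zero_le)
  refine iSup_le fun x => ?_
  obtain ⟨K, hK⟩ : ∃ K : ℕ, c₁ ^ K * Metric.diam J < r := by
    obtain ⟨K, hK⟩ := exists_pow_lt_of_lt_one (y := c₁) (div_pos (NNReal.coe_pos.mpr hr) hJ0)
      hc.lt_one
    exact ⟨K, (lt_div_iff₀ hJ0).mp hK⟩
  have hrR' : (r : ℝ) ≤ R := hrR
  have hsize : ∀ τ ∈ M.words K, B.size τ ≤ r := fun τ hτ =>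
    (B.size_words hJ0 hc hτ).2.trans hK.le
  have hcutR : ∀ τ ∈ M.words K, ∃ i, i < K ∧ B.IsCut R i (τ.take (i + 1)) := fun τ hτ =>
    exists_isCut_take hRJ hτ ((hsize τ hτ).trans hrR')
  have hcutr : ∀ τ ∈ M.words K, ∃ i, i < K ∧ B.IsCut r i (τ.take (i + 1)) := fun τ hτ =>
    exists_isCut_take (hrR'.trans_lt hRJ) hτ (hsize τ hτ)
  choose! I hIK hI using hcutR
  choose! i hiK hi using hcutr
  have hIi : ∀ τ ∈ M.words K, I τ ≤ i τ := by
    intro τ hτ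
    by_contra! hlt
    have h := B.size_le_size_take hJ
      (take_mem_words (hI τ hτ).mem (Nat.le_succ (I τ))) (show i τ + 1 ≤ I τ from hlt)
    rw [List.take_take, List.take_take, min_eq_left (by omega), min_eq_left (by omega)] at h
    have h2 := (hI τ hτ).lt_size
    rw [List.take_take, min_eq_left (by omega)] at h2
    linarith [(hi τ hτ).size_le]
  -- The words of length `K` whose basic sets meet the ball, and their prefixes of sizes `R`, `r`.
  let W := (M.descendants [] K).filter fun τ =>
    (B.set τ ∩ Metric.closedBall (x : EuclideanSpace ℝ (Fin d)) R).Nonempty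
  have hW : ∀ {τ}, τ ∈ W ↔ τ ∈ M.words K ∧
      (B.set τ ∩ Metric.closedBall (x : EuclideanSpace ℝ (Fin d)) R).Nonempty := by
    intro τ
    rw [Finset.mem_filter, mem_descendants nil_mem_words, zero_add]
    simp
  let S := W.image fun τ => τ.take (I τ + 1)
  let T := W.image fun τ => τ.take (i τ + 1)
  have hScard : (S.card : ℝ) ≤ a := by
    refine hS S x (fun σ hσ => ?_) fun σ hσ => ?_
    · obtain ⟨τ, hτ, rfl⟩ := Finset.mem_image.mp hσ
      exact ⟨_, hI τ (hW.mp hτ).1⟩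
    · obtain ⟨τ, hτ, rfl⟩ := Finset.mem_image.mp hσ
      obtain ⟨hτK, hne⟩ := hW.mp hτ
      exact hne.mono (inter_subset_inter_left _ (B.set_subset_take hτK (hIK τ hτK)))
  have hTsub : T ⊆ S.biUnion fun σ => T.filter fun τ => σ <+: τ := by
    intro τ' hτ'
    obtain ⟨τ, hτ, rfl⟩ := Finset.mem_image.mp hτ'
    refine Finset.mem_biUnion.mpr ⟨τ.take (I τ + 1), Finset.mem_image_of_mem _ hτ,
      Finset.mem_filter.mpr ⟨hτ', ?_⟩⟩
    exact List.take_prefix_take_left (Nat.succ_le_succ (hIi τ (hW.mp hτ).1))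
  have hTcard : (T.card : ℝ) ≤ a * b := by
    calc (T.card : ℝ) ≤ ∑ σ ∈ S, ((T.filter fun τ => σ <+: τ).card : ℝ) := by
          exact_mod_cast (Finset.card_le_card hTsub).trans Finset.card_biUnion_le
      _ ≤ ∑ _σ ∈ S, b := by
          refine Finset.sum_le_sum fun σ hσ => ?_
          obtain ⟨τ, hτ, rfl⟩ := Finset.mem_image.mp hσ
          have hcut := hI τ (hW.mp hτ).1
          refine hT _ _ _ hcut fun ρ hρ => ?_
          obtain ⟨hρT, hpre⟩ := Finset.mem_filter.mp hρ
          obtain ⟨τ₂, hτ₂, rfl⟩ := Finset.mem_image.mp hρT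
          have hcut₂ := hi τ₂ (hW.mp hτ₂).1
          have hlen := hpre.length_le
          rw [hcut.mem.1, hcut₂.mem.1] at hlen
          refine ⟨i τ₂ + 1 - (I τ + 1), (mem_descendants hcut.mem).mpr ⟨?_, hpre⟩, _, hcut₂⟩
          rw [Nat.add_sub_cancel' hlen]
          exact hcut₂.mem
      _ = S.card * b := by rw [Finset.sum_const, nsmul_eq_mul]
      _ ≤ a * b := by gcongr
  have hpt : ∀ τ ∈ T, ∃ y : B.limitSet, (y : EuclideanSpace ℝ (Fin d)) ∈ B.set τ := by
    intro τ' hτ'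
    obtain ⟨τ, hτ, rfl⟩ := Finset.mem_image.mp hτ'
    obtain ⟨y, hy, hyE⟩ := B.inter_limitSet_nonempty hJ hJne (hi τ (hW.mp hτ).1).mem
    exact ⟨⟨y, hyE⟩, hy⟩
  have : Nonempty B.limitSet := ⟨x⟩
  choose! y hy using hpt
  have hcover : Metric.IsCover r (Metric.closedBall x (R : ℝ))
      ((T.image y : Finset B.limitSet) : Set B.limitSet) := by
    intro z hz
    obtain ⟨τ, hτ, hzτ⟩ := mem_iUnion₂.mp (mem_iInter.mp z.2 K)
    have hτW : τ ∈ W := hW.mpr ⟨hτ, z, hzτ, hz⟩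
    have hτT : τ.take (i τ + 1) ∈ T := Finset.mem_image_of_mem _ hτW
    refine ⟨_, Finset.mem_coe.mpr (Finset.mem_image_of_mem y hτT), ?_⟩
    have hdist : dist z (y (τ.take (i τ + 1))) ≤ r :=
      (Metric.dist_le_diam_of_mem (B.isCompact_set hJ (hi τ hτ).mem).isBounded
        (B.set_subset_take hτ (hiK τ hτ) hzτ) (hy _ hτT)).trans (hi τ hτ).size_le
    change edist z _ ≤ r
    rw [edist_nndist, ENNReal.coe_le_coe]
    exact_mod_cast hdist
  refine hcover.externalCoveringNumber_le_encard.trans ?_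
  rw [Set.encard_coe_eq_coe_finsetCard]
  have hcard : T.card ≤ ⌊v⌋₊ := Nat.le_floor (by
    rw [← NNReal.coe_le_coe]
    exact_mod_cast hTcard.trans hv)
  exact_mod_cast Finset.card_image_le.trans hcard

/-- If `s` exceeds the `limsup` for `η = δ log c₁ / (2 log c₀)`, then `Δ_{p,q}(s) ≤ 1` for all
levels `p`, `q` that occur between radii `R` and `r` with `r ^ (1 - δ) ≤ R`, so that
`N_{r,R}` is bounded by a multiple of `(R / r) ^ (s + e)` for every `e > 0`. -/
theorem exists_hExponent_le_limsup (hJ : IsCompact J) (hJint : (interior J).Nonempty)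
    (hJ0 : 0 < Metric.diam J) {c₀ c₁ : ℝ} (hc : M.RatioBounds c₀ c₁) {δ : ℝ} (hδ0 : 0 < δ)
    (hδ1 : δ < 1) : ∃ η ∈ Ioo (0 : ℝ) 1,
      hExponent B.limitSet δ ≤ limsup (fun q : ℕ => M.maxExponent η q) atTop := by
  have hc0 := hc.pos
  have hc1 : 0 < c₁ := hc.pos.trans_le hc.le
  have hc01 : c₀ < 1 := hc.le.trans_lt hc.lt_one
  have hl1 := Real.log_neg hc1 hc.lt_one
  have hl10 := Real.log_le_log hc.pos hc.le
  have hl0 : Real.log c₀ < 0 := by linarith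
  obtain ⟨η, hη⟩ : ∃ η, η = δ * Real.log c₁ / (2 * Real.log c₀) := ⟨_, rfl⟩
  have hη0 : 0 < η := by
    rw [hη]; exact div_pos_of_neg_of_neg (mul_neg_of_pos_of_neg hδ0 hl1) (by linarith)
  have hη1 : η < 1 := by
    rw [hη, div_lt_one_of_neg (by linarith)]
    nlinarith
  refine ⟨η, ⟨hη0, hη1⟩, ENNReal.le_of_forall_pos_le_add fun ε hε hL => ?_⟩
  obtain ⟨L, hLeq⟩ := WithTop.ne_top_iff_exists.mp hL.ne
  replace hLeq : ((L : ℝ≥0) : ℝ≥0∞) = _ := hLeq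
  rw [← hLeq, ← ENNReal.coe_add]
  obtain ⟨κ, hκ, hpack⟩ := B.exists_packing_bound hJ hJint hJ0
  have hε2 : 0 < ε / 2 := half_pos hε
  have hev : ∀ᶠ q : ℕ in atTop, M.maxExponent η q < ((L + ε / 2 : ℝ≥0) : ℝ≥0∞) := by
    refine eventually_lt_of_limsup_lt ?_
    rw [← hLeq]
    exact_mod_cast lt_add_of_pos_right L hε2
  have hlarge : ∀ᶠ q : ℕ in atTop,
      3 + |Real.log (Metric.diam J)| / -Real.log c₀ ≤ η * q :=
    (tendsto_natCast_atTop_atTop.const_mul_atTop hη0).eventually_ge_atTop _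
  obtain ⟨Q, hQ⟩ := eventually_atTop.mp (hev.and hlarge)
  obtain ⟨ℓ, hℓ⟩ : ∃ ℓ : ℝ≥0, (ℓ : ℝ) = Metric.diam J := ⟨⟨_, hJ0.le⟩, rfl⟩
  obtain ⟨γ, hγ⟩ : ∃ γ : ℝ≥0, (γ : ℝ) = c₀ := ⟨⟨_, hc0.le⟩, rfl⟩
  have hℓ0 : 0 < ℓ := by rw [← NNReal.coe_pos, hℓ]; exact hJ0
  have hγ0 : 0 < γ := by rw [← NNReal.coe_pos, hγ]; exact hc0
  obtain ⟨s, hs⟩ : ∃ s : ℝ, s = ((L + ε / 2 : ℝ≥0) : ℝ) := ⟨_, rfl⟩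
  obtain ⟨e, he⟩ : ∃ e : ℝ, e = ((ε / 2 : ℝ≥0) : ℝ) := ⟨_, rfl⟩
  have hs0 : 0 ≤ s := hs ▸ NNReal.coe_nonneg _
  have he0 : 0 < e := he ▸ NNReal.coe_pos.mpr hε2
  have hse : s + e = ((L + ε : ℝ≥0) : ℝ) := by
    rw [hs, he, ← NNReal.coe_add, add_assoc, add_halves]
  have hβ1 : c₁ ^ e < 1 := Real.rpow_lt_one hc1.le hc.lt_one he0
  have hC : 0 < κ * (2 / c₀) ^ d * ((1 - c₁ ^ e)⁻¹ * (c₀ ^ (s + e))⁻¹) := by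
    have : 0 < 1 - c₁ ^ e := by linarith
    positivity
  obtain ⟨C, hCval⟩ : ∃ C : ℝ≥0,
      (C : ℝ) = κ * (2 / c₀) ^ d * ((1 - c₁ ^ e)⁻¹ * (c₀ ^ (s + e))⁻¹) := ⟨⟨_, hC.le⟩, rfl⟩
  have hC0 : 0 < C := by rw [← NNReal.coe_pos, hCval]; exact hC
  -- Radii below `b` only involve levels beyond `Q`.
  refine iInf₂_le_of_le (L + ε) ⟨min ℓ ((ℓ * γ ^ Q) ^ (1 - δ)), C,
    lt_min hℓ0 (NNReal.rpow_pos (by positivity)), hC0, fun r R hr hr1 hrR hRb => ?_⟩ le_rfl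
  have hrR' : (r : ℝ) ^ (1 - δ) ≤ R := by exact_mod_cast hrR
  have hR0 : 0 < R := hr.trans (hr1.trans_le hrR)
  have hr0' : (0 : ℝ) < r := NNReal.coe_pos.mpr hr
  have hR0' : (0 : ℝ) < R := NNReal.coe_pos.mpr hR0
  have hRJ : (R : ℝ) < Metric.diam J := by
    rw [← hℓ]
    exact_mod_cast hRb.trans_le (min_le_left _ _)
  have hrQ : (r : ℝ) < c₀ ^ Q * Metric.diam J := by
    have h : r < ℓ * γ ^ Q := (NNReal.rpow_lt_rpow_iff (by linarith : 0 < 1 - δ)).mp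
      (hrR.trans_lt (hRb.trans_le (min_le_right _ _)))
    rw [mul_comm, ← hℓ, ← hγ]
    exact_mod_cast h
  refine B.coverNum_le hJ hJint hJ0 hc hr (hr1.le.trans hrR) hRJ (a := κ * (2 / c₀) ^ d)
    (b := (1 - c₁ ^ e)⁻¹ * (c₀ ^ (s + e))⁻¹ * ((R : ℝ) / r) ^ (s + e)) ?_ ?_ ?_ ?_
  · have : 0 < 1 - c₁ ^ e := by linarith
    positivity
  · intro S x hS hSx
    choose! k hk using hS
    have h := hpack S x R (c₀ * R) R (by positivity) hR0'.le hR0'.le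
      (fun σ hσ => ⟨_, (hk σ hσ).mem⟩)
      (fun σ hσ τ hτ hne => (hk σ hσ).disjoint_interior hJ (hk τ hτ) hne)
      (fun σ hσ => ⟨(hk σ hσ).mul_le_size hc hJ0, (hk σ hσ).size_le, hSx σ hσ⟩)
    refine h.trans_eq ?_
    congr 2
    field_simp
    norm_num
  · intro k σ T hσ hT
    refine card_le_of_delta_le_one hJ0 hc hσ.mem hr0' hσ.size_le hs0 he0 fun τ hτ => ?_
    obtain ⟨n, hn, l, hl⟩ := hT τ hτ
    have hlow := hl.mul_le_size hc hJ0
    refine ⟨n, hn, hlow, ?_⟩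
    have hQn : Q ≤ k + 1 + n := by
      have h1 := ((B.size_words hJ0 hc ((mem_descendants hσ.mem).mp hn).1).1.trans
        hl.size_le).trans_lt hrQ
      exact ((pow_lt_pow_iff_right_of_lt_one₀ hc0 hc01).mp
        (lt_of_mul_lt_mul_right h1 hJ0.le)).le
    obtain ⟨hmax, hlrg⟩ := hQ _ hQn
    rw [hη] at hlrg
    have hlev := level_le_of_rpow_le hJ0 hc hσ.mem hn hr0' hδ1 hδ0 hrR'
      (hσ.mul_le_size hc hJ0) hlow hl.size_le hlrg
    rw [← hη] at hlev
    have hle : k + 1 + 1 ≤ k + 1 + n := by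
      have h : ((k + 1 + 1 : ℕ) : ℝ) ≤ ((k + 1 + n : ℕ) : ℝ) :=
        hlev.trans (mul_le_of_le_one_right (Nat.cast_nonneg _) (by linarith))
      exact_mod_cast h
    refine delta_le_one (by omega) hle ?_
    have h := (le_iSup₂_of_le (f := fun (p : ℕ)
      (_ : 1 ≤ p ∧ (p : ℝ) ≤ ((k + 1 + n : ℕ) : ℝ) * (1 - η)) =>
        ENNReal.ofReal (M.exponent p (k + 1 + n))) (k + 1 + 1) ⟨by omega, hlev⟩ le_rfl).trans_lt
      hmax
    rw [← ENNReal.ofReal_coe_nnreal, ← hs] at h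
    exact (ENNReal.ofReal_lt_ofReal_iff'.mp h).1.le
  · refine le_of_eq ?_
    rw [NNReal.coe_mul, NNReal.coe_rpow, NNReal.coe_div, hCval, ← hse]
    ring

end BasicSets

/-! ### The formula for the quasi-Assouad dimension -/

theorem antitone_limsup_maxExponent (M : MoranData) :
    Antitone fun η : ℝ => limsup (fun q : ℕ => M.maxExponent η q) atTop := by
  intro η η' h
  refine limsup_le_limsup (Eventually.of_forall fun q => ?_)
  refine iSup_mono fun p => iSup_mono' fun hp => ⟨⟨hp.1, hp.2.trans ?_⟩, le_rfl⟩
  gcongr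

end MoranData

theorem proposition2 (d : ℕ) (hd : 1 ≤ d) (J : Set (EuclideanSpace ℝ (Fin d)))
    (hJ : IsCompact J) (hJint : (interior J).Nonempty) (M : MoranData)
    (hc : ∃ c₀ : ℝ, 0 < c₀ ∧ ∀ k j, 1 ≤ k → 1 ≤ j → j ≤ M.n k → c₀ ≤ M.c k j)
    (E : Set (EuclideanSpace ℝ (Fin d))) (hE : M.IsMoranSet J E) :
    Tendsto (fun η : ℝ => limsup (fun q : ℕ => M.maxExponent η q) atTop)
      (𝓝[>] (0 : ℝ)) (𝓝 (qaDim E)) := by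
  obtain ⟨I, h1, h2, h3, h4, h5, rfl⟩ := hE
  let B : M.BasicSets J := ⟨I, h1, h2, h3, h4, h5⟩
  change Tendsto _ _ (𝓝 (qaDim B.limitSet))
  have hJ0 := MoranData.BasicSets.diam_pos hJ hJint hd
  obtain ⟨c₀, h0, hc⟩ := hc
  obtain ⟨c₁, hc⟩ := B.exists_ratioBounds hJ hJint hJ0 hd h0 hc
  -- Both functions are antitone near `0`, so their limits are suprema, which are compared.
  have hne : (Ioo (0 : ℝ) 1).Nonempty := nonempty_Ioo.mpr zero_lt_one
  have hL := (M.antitone_limsup_maxExponent.antitoneOn _).tendsto_nhdsWithin_Ioo_right hne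
    (OrderTop.bddAbove _)
  have hh := (hExponent_antitoneOn B.limitSet).tendsto_nhdsWithin_Ioo_right hne
    (OrderTop.bddAbove _)
  rw [tendsto_nhds_unique (tendsto_hExponent B.limitSet) hh]
  convert hL using 2
  refine le_antisymm (sSup_le ?_) (sSup_le ?_)
  · rintro _ ⟨δ, hδ, rfl⟩
    obtain ⟨η, hη, hle⟩ := B.exists_hExponent_le_limsup hJ hJint hJ0 hc hδ.1 hδ.2
    exact hle.trans (le_sSup (mem_image_of_mem _ hη))
  · rintro _ ⟨η, hη, rfl⟩
    obtain ⟨δ, hδ, hle⟩ := B.exists_limsup_le_hExponent hJ hJint hJ0 hc hη.1 hη.2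
    exact hle.trans (le_sSup (mem_image_of_mem _ hδ))
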